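/- Let $M=2^\lambda$ with $\lambda\ge 1$ an integer, let $\mathcal S=\{e^{j(2k+1)\pi/M}:0\le k\le M-1\}$ be the $M$-PSK signal set and $\Delta\mathcal S=\{s-s':s,s'\in\mathcal S\}$. The singular fade states are the numbers $-d_k/d_l$ with $d_k,d_l\in\Delta\mathcal S$, $d_l\ne 0$. The region associated with $-d_k/d_l$ is $$\mathcal R_{\{-d_k/d_l\}}=\{z\in\mathbb C:\ |d_k+z d_l|\le |d_k'+z d_l'|\ \text{ for all }(d_k',d_l')\in\Delta\mathcal S\times\Delta\mathcal S,\ (d_k',d_l')\ne(0,0),(d_k,d_l)\},$$ and the pairwise transition boundary of two singular fade states is $c(-d_k/d_l,-d_k'/d_l')=\{z:|d_k+zd_l|=|d_k'+zd_l'|\}$. The inner envelope region formed by a point $p$ and a family of circles and straight lines not containing $p$ is the set of points which, for every curve of the family, lie on the same closed side of that curve as $p$ (the closed disc, the closed exterior, or the closed half-plane that contains $p$). **Theorem 2.** Let $a\in\{0,\pi/M\}$, and let $h=-d_k/d_l$ be a singular fade state with phase angle $a$ and $|h|>1$. Then $\mathcal R_{\{-d_k/d_l\}}$ is the inner envelope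 region formed by the point $h$ and the following curves: 1. the unit circle centered at the origin; 2. the curves $c(-d_k/d_l,-d_k'/d_l')$ for the singular fade states $-d_k'/d_l'\ne h$ with phase angle $a$ and $|d_k'/d_l'|\ge 1$; 3. if no singular fade state with phase angle $a$ has modulus larger than $|h|$, the unit circle centered at $h$; 4. the curves $c(-d_k/d_l,-d_k'/d_l')$ for the singular fade states $-d_k'/d_l'$ with phase angle $a-\pi/M$ or $a+\pi/M$ and $|d_k'/d_l'|\ge 1$; 5. the straight lines $\theta=a-\pi/M$ and $\theta=a+\pi/M$ through the origin. In items 2 and 4, all representations $-d_k'/d_l'$ with $d_k',d_l'\in\Delta\mathcal S$ of the singular fade states in question are taken. -/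

import Mathlib

/-- The symmetric `M`-PSK signal set: the points `e^{j(2k+1)π/M}`, `0 ≤ k ≤ M - 1`. -/
def psk (M : ℕ) : Set ℂ :=
  {x | ∃ k : ℕ, k < M ∧ x = Complex.exp (((2 * (k : ℝ) + 1) * Real.pi / (M : ℝ) : ℝ) * Complex.I)}

/-- The difference constellation `ΔS` of the `M`-PSK signal set. -/
def diffConstellation (M : ℕ) : Set ℂ :=
  {d | ∃ s ∈ psk M, ∃ s' ∈ psk M, d = s - s'}

/-- `h` is a singular fade state: two different pairs of transmitted symbols give the same
received point `x_A + h x_B`, that is, the minimum distance of the received constellation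
is zero at `h`. -/
def IsSingularFadeState (M : ℕ) (h : ℂ) : Prop :=
  ∃ xA ∈ psk M, ∃ xB ∈ psk M, ∃ xA' ∈ psk M, ∃ xB' ∈ psk M,
    (xA, xB) ≠ (xA', xB') ∧ (xA - xA') + h * (xB - xB') = 0

/-- `h` is written as `-d_k / d_l` with `d_k, d_l` in the difference constellation. -/
def IsRatio (M : ℕ) (h dk dl : ℂ) : Prop :=
  dk ∈ diffConstellation M ∧ dl ∈ diffConstellation M ∧ dl ≠ 0 ∧ h = -dk / dl

/-- The singular fade states are exactly the ratios `-d_k / d_l`. -/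
theorem isSingularFadeState_iff (M : ℕ) (h : ℂ) :
    IsSingularFadeState M h ↔ ∃ dk dl : ℂ, IsRatio M h dk dl := by
  constructor
  · rintro ⟨xA, hA, xB, hB, xA', hA', xB', hB', hne, he⟩
    have hd : xB - xB' ≠ 0 := by
      intro h0
      apply hne
      rw [h0, mul_zero, add_zero] at he
      rw [sub_eq_zero.mp he, sub_eq_zero.mp h0]
    refine ⟨xA - xA', xB - xB', ⟨xA, hA, xA', hA', rfl⟩, ⟨xB, hB, xB', hB', rfl⟩, hd, ?_⟩
    rw [eq_div_iff hd]
    linear_combination he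
  · rintro ⟨dk, dl, ⟨xA, hA, xA', hA', rfl⟩, ⟨xB, hB, xB', hB', rfl⟩, hd, he⟩
    refine ⟨xA, hA, xB, hB, xA', hA', xB', hB', ?_, ?_⟩
    · intro h0
      exact hd (sub_eq_zero.mpr (Prod.ext_iff.mp h0).2)
    · rw [he, div_mul_cancel₀ _ hd]
      ring

/-- The region associated with the singular fade state `-d_k / d_l`: the fade states at which
`|d_k + z d_l|` is the least of the distances between points of the received constellation,
these distances being `|d_k' + z d_l'|` with `(d_k', d_l') ≠ (0, 0)`. -/
def fadeRegion (M : ℕ) (dk dl : ℂ) : Set ℂ :=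
  {z | ∀ dk' ∈ diffConstellation M, ∀ dl' ∈ diffConstellation M,
    (dk', dl') ≠ (0, 0) → (dk', dl') ≠ (dk, dl) → ‖dk + z * dl‖ ≤ ‖dk' + z * dl'‖}

/-- The pairwise transition boundary `c(-d_k/d_l, -d_k'/d_l')`. -/
def transitionBoundary (dk dl dk' dl' : ℂ) : Set ℂ :=
  {z | ‖dk + z * dl‖ = ‖dk' + z * dl'‖}

/-- The points with phase angle `α` (polar coordinates `γ ≥ 0`, `θ = α`). -/
def phaseRay (α : ℝ) : Set ℂ :=
  {z | ∃ γ : ℝ, 0 ≤ γ ∧ z = γ * Complex.exp (α * Complex.I)}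

/-- The straight line through the origin with direction `α`. -/
def straightLine (α : ℝ) : Set ℂ :=
  {z | ∃ t : ℝ, z = t * Complex.exp (α * Complex.I)}

/-- The side of the boundary `C` on which `p` lies, with its boundary: for a circle the closed
disc or the closed exterior, for a straight line a closed half-plane. -/
def closedSide (C : Set ℂ) (p : ℂ) : Set ℂ :=
  closure (connectedComponentIn Cᶜ p)

/-- The inner envelope region formed by the point `p` and a family of circles and straight
lines: the points that no boundary of the family separates from `p`. -/
def innerEnvelopeRegion (p : ℂ) (F : Set (Set ℂ)) : Set ℂ :=
  {z | ∀ C ∈ F, z ∈ closedSide C p}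

/-- The boundaries contributed by the line `θ = a` on which `h = -d_k / d_l` lies: the unit
circle centred at the origin, the transition boundaries with the other singular fade states of
modulus at least one on that line, and, if none of these is farther out than `h`, the unit
circle centred at `h`. -/
def sameLineCurves (M : ℕ) (a : ℝ) (h dk dl : ℂ) : Set (Set ℂ) :=
  {C | C = Metric.sphere 0 1} ∪
  {C | ∃ h' dk' dl' : ℂ, IsRatio M h' dk' dl' ∧ h' ∈ phaseRay a ∧ h' ≠ h ∧ 1 ≤ ‖h'‖ ∧
    C = transitionBoundary dk dl dk' dl'} ∪
  {C | (¬ ∃ h' : ℂ, IsSingularFadeState M h' ∧ h' ∈ phaseRay a ∧ ‖h‖ < ‖h'‖) ∧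
    C = Metric.sphere h 1}

/-- The boundaries contributed by the neighbouring lines `θ = a ± π/M`: the transition
boundaries with the singular fade states of modulus at least one on these lines. -/
noncomputable def neighbourLineCurves (M : ℕ) (a : ℝ) (dk dl : ℂ) : Set (Set ℂ) :=
  {C | ∃ h' dk' dl' : ℂ, IsRatio M h' dk' dl' ∧
    (h' ∈ phaseRay (a - Real.pi / M) ∨ h' ∈ phaseRay (a + Real.pi / M)) ∧ 1 ≤ ‖h'‖ ∧
    C = transitionBoundary dk dl dk' dl'}

/-- The two straight lines `θ = a - π/M` and `θ = a + π/M`. -/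
noncomputable def wedgeLines (M : ℕ) (a : ℝ) : Set (Set ℂ) :=
  {straightLine (a - Real.pi / M), straightLine (a + Real.pi / M)}

/-! Put x = π/M and z = e^{jex} w, where h has phase ex and e is 0 or 1. Both sets turn out to be
given by the same four conditions: w lies in the wedge of half-angle x about the positive real axis,
|w| ≥ 1, `RayConditions`, and |z - h| ≤ 1 when h is outermost on its ray. On the envelope side this
holds because every curve is the zero set of a real quadratic form negative at h
(`closedSide_circleForm`).

A point of the region satisfies the conditions because each of them is a comparison with one
particular pair. Conversely, let z satisfy them and let (dk', dl') be any nonzero pair. If |dk'| ≥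
|dl'| > 0, turning dk' by a multiple of 2x moves -dk'/dl' to one of three rays without increasing
the distance. A ray condition then applies, unless the new ratio is h itself. In that case the
distances agree, because a state with |h| > 1 determines |dl|; this uses that M is a power of two
(`sin_mul_sin_unique`). If 0 < |dk'| < |dl'|, the conjugate swap `normSq_swap_sub` and |z| ≥ 1
reduce to the previous case.

If one entry is zero, the bound needed is |dk + z dl| ≤ 2 sin x, the least nonzero difference. For
outermost h it is the disc condition. Otherwise comparison with the outermost state bounds Re w, and
the truncated wedge is covered by unit discs about states with denominator 2 sin x (`wedge_cover`).
-/

/-! ### Closed sides of circles and lines -/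

/-- By the intermediate value theorem the component of p cannot leave f < 0, and that set is itself
connected. -/
theorem closedSide_eq_of_continuous {f : ℂ → ℝ} (hf : Continuous f) {p : ℂ} (hp : f p < 0)
    (hconn : IsPreconnected {z | f z < 0}) (hcl : {z | f z ≤ 0} ⊆ closure {z | f z < 0}) :
    closedSide {z | f z = 0} p = {z | f z ≤ 0} := by
  have hcomp : connectedComponentIn {z | f z = 0}ᶜ p = {z | f z < 0} := by
    apply Set.Subset.antisymm
    · intro z hz
      by_contra hzn
      have hzn' : 0 ≤ f z := not_lt.mp hzn
      have hpm : p ∈ connectedComponentIn {z | f z = 0}ᶜ p :=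
        mem_connectedComponentIn (by simpa using hp.ne)
      obtain ⟨w, hw, hw0⟩ := isPreconnected_connectedComponentIn.intermediate_value hpm hz
        hf.continuousOn ⟨hp.le, hzn'⟩
      exact connectedComponentIn_subset _ _ hw hw0
    · exact hconn.subset_connectedComponentIn hp (fun z (hz : f z < 0) => hz.ne)
  rw [closedSide, hcomp]
  exact Set.Subset.antisymm
    (closure_minimal (fun z (hz : f z < 0) => hz.le) (isClosed_le hf continuous_const)) hcl

theorem isPreconnected_norm_sub_gt (c : ℂ) {r : ℝ} (hr : 0 ≤ r) :
    IsPreconnected {z : ℂ | r < ‖z - c‖} := by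
  have himg : {z : ℂ | r < ‖z - c‖} =
      (fun q : ℝ × ℝ => c + q.1 * Complex.exp (q.2 * Complex.I)) '' (Set.Ioi r ×ˢ Set.univ) := by
    ext z
    constructor
    · intro hz
      refine ⟨(‖z - c‖, (z - c).arg), ⟨hz, trivial⟩, ?_⟩
      simp [Complex.norm_mul_exp_arg_mul_I]
    · rintro ⟨⟨ρ, θ⟩, ⟨hρ, -⟩, rfl⟩
      have hρ' : r < ρ := hρ
      simpa [Complex.norm_exp_ofReal_mul_I, abs_of_pos (hr.trans_lt hρ')] using hρ'
  rw [himg]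
  exact (isPreconnected_Ioi.prod isPreconnected_univ).image _ (by fun_prop)

/-- The general real quadratic form `α |z|² + b Re z + c Im z + d`. -/
def circleForm (α b c d : ℝ) (z : ℂ) : ℝ := α * Complex.normSq z + b * z.re + c * z.im + d

theorem continuous_circleForm (α b c d : ℝ) : Continuous (circleForm α b c d) := by
  unfold circleForm
  have := Complex.continuous_normSq
  fun_prop

/-- The defect in this convexity inequality is exactly α s t |z - w|². -/
theorem circleForm_segment_le {α : ℝ} (hα : 0 ≤ α) (b c d : ℝ) (z w : ℂ) {s t : ℝ}
    (hs : 0 ≤ s) (ht : 0 ≤ t) (hst : s + t = 1) :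
    circleForm α b c d (s • z + t • w) ≤ s * circleForm α b c d z + t * circleForm α b c d w := by
  obtain rfl : s = 1 - t := by linarith
  have : (1 - t) * circleForm α b c d z + t * circleForm α b c d w
      - circleForm α b c d ((1 - t) • z + t • w) = α * (1 - t) * t * Complex.normSq (z - w) := by
    simp only [circleForm, Complex.normSq_apply, Complex.add_re, Complex.add_im, Complex.sub_re,
      Complex.sub_im, Complex.smul_re, Complex.smul_im, smul_eq_mul]
    ring
  have h0 : 0 ≤ α * (1 - t) * t * Complex.normSq (z - w) := by
    have := Complex.normSq_nonneg (z - w)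
    positivity
  linarith

theorem mem_closure_of_small_step {s : Set ℂ} {z v : ℂ}
    (h : ∀ t : ℝ, 0 < t → t < 1 → z + t • v ∈ s) : z ∈ closure s := by
  have hc : Continuous (fun t : ℝ => z + t • v) := by fun_prop
  have ht : Filter.Tendsto (fun t : ℝ => z + t • v) (nhdsWithin 0 (Set.Ioi 0)) (nhds z) := by
    have := (hc.tendsto 0).mono_left (nhdsWithin_le_nhds (s := Set.Ioi (0 : ℝ)))
    simpa using this
  refine mem_closure_of_tendsto ht ?_
  filter_upwards [Ioo_mem_nhdsGT (zero_lt_one' ℝ)] with t ht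
  exact h t ht.1 ht.2

theorem closedSide_circleForm_of_nonneg {α : ℝ} (hα : 0 ≤ α) (b c d : ℝ) {p : ℂ}
    (hp : circleForm α b c d p < 0) :
    closedSide {z | circleForm α b c d z = 0} p = {z | circleForm α b c d z ≤ 0} := by
  refine closedSide_eq_of_continuous (continuous_circleForm α b c d) hp ?_ ?_
  · apply Convex.isPreconnected
    intro z hz w hw s t hs ht hst
    have hz' : circleForm α b c d z < 0 := hz
    have hw' : circleForm α b c d w < 0 := hw
    have := circleForm_segment_le hα b c d z w hs ht hst
    have h2 : s * circleForm α b c d z + t * circleForm α b c d w < 0 := by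
      rcases hs.eq_or_lt with rfl | hs'
      · have : t = 1 := by linarith
        subst this; linarith
      · nlinarith [mul_pos_of_neg_of_neg hz' (neg_lt_zero.mpr hs'), mul_nonneg ht (neg_nonneg.mpr hw'.le)]
    exact this.trans_lt h2
  · intro z hz
    have hz' : circleForm α b c d z ≤ 0 := hz
    refine mem_closure_of_small_step (v := p - z) fun t h0 h1 => ?_
    have := circleForm_segment_le hα b c d z p (sub_nonneg.mpr h1.le) h0.le (by ring)
    have he : (1 - t) • z + t • p = z + t • (p - z) := by
      module
    rw [he] at this
    refine this.trans_lt ?_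
    nlinarith [mul_pos h0 (neg_pos.mpr hp), mul_nonneg (sub_nonneg.mpr h1.le) (neg_nonneg.mpr hz')]

/-- Completing the square gives α|z - o|² + δ. The positive value at w forces δ > 0, so the zero set
is a genuine circle and the negative set its exterior, connected but not convex. -/
theorem closedSide_circleForm_of_neg {α : ℝ} (hα : α < 0) (b c d : ℝ) {p w : ℂ}
    (hp : circleForm α b c d p < 0) (hw : 0 < circleForm α b c d w) :
    closedSide {z | circleForm α b c d z = 0} p = {z | circleForm α b c d z ≤ 0} := by
  set o : ℂ := ⟨-b / (2 * α), -c / (2 * α)⟩ with ho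
  set δ : ℝ := d - (b ^ 2 + c ^ 2) / (4 * α) with hδ
  have hform : ∀ z, circleForm α b c d z = α * ‖z - o‖ ^ 2 + δ := by
    intro z
    rw [← Complex.normSq_eq_norm_sq]
    simp only [circleForm, Complex.normSq_apply, Complex.sub_re, Complex.sub_im, ho, hδ]
    have := hα.ne
    field_simp
    ring
  have hδ0 : 0 < δ := by
    rw [hform] at hw
    nlinarith [sq_nonneg ‖w - o‖, mul_nonneg (neg_nonneg.mpr hα.le) (sq_nonneg ‖w - o‖)]
  obtain ⟨r, hr, hr2⟩ : ∃ r : ℝ, 0 < r ∧ δ = -α * r ^ 2 := by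
    have h0 : 0 < δ / (-α) := div_pos hδ0 (by linarith)
    refine ⟨Real.sqrt (δ / (-α)), Real.sqrt_pos.mpr h0, ?_⟩
    rw [Real.sq_sqrt h0.le]
    have := hα.ne
    field_simp
  have hdiff : ∀ z, circleForm α b c d z = -α * (r ^ 2 - ‖z - o‖ ^ 2) := by
    intro z
    rw [hform, hr2]
    ring
  have hlt_iff : ∀ z, circleForm α b c d z < 0 ↔ r < ‖z - o‖ := by
    intro z
    rw [← pow_lt_pow_iff_left₀ hr.le (norm_nonneg _) two_ne_zero, hdiff]
    constructor <;> intro h <;> nlinarith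
  have hlt : {z | circleForm α b c d z < 0} = {z | r < ‖z - o‖} := Set.ext hlt_iff
  refine closedSide_eq_of_continuous (continuous_circleForm α b c d) hp ?_ ?_
  · rw [hlt]
    exact isPreconnected_norm_sub_gt o hr.le
  · intro z hz
    have hz' : circleForm α b c d z ≤ 0 := hz
    have hzr : r ≤ ‖z - o‖ := by
      rw [hdiff] at hz'
      rw [← pow_le_pow_iff_left₀ hr.le (norm_nonneg _) two_ne_zero]
      nlinarith
    refine mem_closure_of_small_step (v := z - o) fun t h0 _ => ?_
    refine (hlt_iff _).mpr ?_
    have he : z + t • (z - o) - o = (1 + t) • (z - o) := by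
      rw [add_smul, one_smul]; ring
    rw [he, norm_smul, Real.norm_eq_abs, abs_of_pos (by linarith)]
    nlinarith [mul_pos h0 (hr.trans_le hzr)]

/-- The closed side of a circle or line on which the quadratic form is negative. -/
theorem closedSide_circleForm (α b c d : ℝ) {p w : ℂ}
    (hp : circleForm α b c d p < 0) (hw : 0 < circleForm α b c d w) :
    closedSide {z | circleForm α b c d z = 0} p = {z | circleForm α b c d z ≤ 0} := by
  rcases le_or_gt 0 α with hα | hα
  · exact closedSide_circleForm_of_nonneg hα b c d hp
  · exact closedSide_circleForm_of_neg hα b c d hp hw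

theorem norm_le_iff_normSq_sub {a b : ℂ} :
    ‖a‖ ≤ ‖b‖ ↔ Complex.normSq a - Complex.normSq b ≤ 0 := by
  rw [sub_nonpos, Complex.normSq_eq_norm_sq, Complex.normSq_eq_norm_sq,
    pow_le_pow_iff_left₀ (norm_nonneg _) (norm_nonneg _) two_ne_zero]

theorem norm_eq_iff_normSq_sub {a b : ℂ} :
    ‖a‖ = ‖b‖ ↔ Complex.normSq a - Complex.normSq b = 0 := by
  rw [sub_eq_zero, Complex.normSq_eq_norm_sq, Complex.normSq_eq_norm_sq,
    pow_left_inj₀ (norm_nonneg _) (norm_nonneg _) two_ne_zero]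

theorem normSq_add_mul_sub_eq_circleForm (dk dl dk' dl' z : ℂ) :
    Complex.normSq (dk + z * dl) - Complex.normSq (dk' + z * dl') =
      circleForm (Complex.normSq dl - Complex.normSq dl')
        (2 * (dk.re * dl.re + dk.im * dl.im) - 2 * (dk'.re * dl'.re + dk'.im * dl'.im))
        (2 * (dk.im * dl.re - dk.re * dl.im) - 2 * (dk'.im * dl'.re - dk'.re * dl'.im))
        (Complex.normSq dk - Complex.normSq dk') z := by
  simp only [circleForm, Complex.normSq_apply, Complex.add_re, Complex.add_im, Complex.mul_re,
    Complex.mul_im]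
  ring

/-- A transition boundary between two distinct singular fade states bounds the set of points at
which the first of the two distances is the smaller one. -/
theorem closedSide_transitionBoundary {dk dl dk' dl' h h' : ℂ} (hdl : dl ≠ 0) (hdl' : dl' ≠ 0)
    (hh : h = -dk / dl) (hh' : h' = -dk' / dl') (hne : h' ≠ h) :
    closedSide (transitionBoundary dk dl dk' dl') h =
      {z | ‖dk + z * dl‖ ≤ ‖dk' + z * dl'‖} := by
  have e1 : ∀ z, dk + z * dl = (z - h) * dl := by
    intro z; rw [hh]; field_simp; ring
  have e2 : ∀ z, dk' + z * dl' = (z - h') * dl' := by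
    intro z; rw [hh']; field_simp; ring
  -- The difference of squared distances is negative at h, where the first distance vanishes, and
  -- positive at h', where the second does.
  have key := closedSide_circleForm (p := h) (w := h')
    (Complex.normSq dl - Complex.normSq dl')
    (2 * (dk.re * dl.re + dk.im * dl.im) - 2 * (dk'.re * dl'.re + dk'.im * dl'.im))
    (2 * (dk.im * dl.re - dk.re * dl.im) - 2 * (dk'.im * dl'.re - dk'.re * dl'.im))
    (Complex.normSq dk - Complex.normSq dk') ?_ ?_
  · simp only [← normSq_add_mul_sub_eq_circleForm, ← norm_le_iff_normSq_sub,
      ← norm_eq_iff_normSq_sub] at key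
    exact key
  · rw [← normSq_add_mul_sub_eq_circleForm, e1, e2, sub_self, zero_mul, map_zero, zero_sub,
      neg_lt_zero, Complex.normSq_pos]
    exact mul_ne_zero (sub_ne_zero.mpr hne.symm) hdl'
  · rw [← normSq_add_mul_sub_eq_circleForm, e1, e2, sub_self, zero_mul, map_zero, sub_zero,
      Complex.normSq_pos]
    exact mul_ne_zero (sub_ne_zero.mpr hne) hdl

theorem closedSide_unitCircle {h : ℂ} (hh : 1 < ‖h‖) :
    closedSide (Metric.sphere 0 1) h = {z | 1 ≤ ‖z‖} := by
  have hf : ∀ z, circleForm (-1) 0 0 1 z = 1 - ‖z‖ ^ 2 := by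
    intro z; rw [← Complex.normSq_eq_norm_sq]; unfold circleForm; ring
  have key := closedSide_circleForm (p := h) (w := 0) (-1) 0 0 1
    (by rw [hf]; nlinarith) (by rw [hf]; norm_num)
  have e1 : Metric.sphere (0 : ℂ) 1 = {z | circleForm (-1) 0 0 1 z = 0} := by
    ext z
    rw [mem_sphere_zero_iff_norm, Set.mem_ofPred_eq, hf]
    constructor
    · intro h; rw [h]; norm_num
    · intro h
      have := norm_nonneg z
      nlinarith
  have e2 : {z : ℂ | 1 ≤ ‖z‖} = {z | circleForm (-1) 0 0 1 z ≤ 0} := by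
    ext z
    rw [Set.mem_ofPred_eq, Set.mem_ofPred_eq, hf]
    constructor <;> intro h <;> nlinarith [norm_nonneg z]
  rw [e1, e2, key]

theorem closedSide_unitCircle_center (h : ℂ) :
    closedSide (Metric.sphere h 1) h = {z | ‖z - h‖ ≤ 1} := by
  have hf : ∀ z, circleForm 1 (-2 * h.re) (-2 * h.im) (Complex.normSq h - 1) z =
      ‖z - h‖ ^ 2 - 1 := by
    intro z; rw [← Complex.normSq_eq_norm_sq]; unfold circleForm
    simp only [Complex.normSq_apply, Complex.sub_re, Complex.sub_im]; ring
  have key := closedSide_circleForm_of_nonneg (p := h) zero_le_one (-2 * h.re) (-2 * h.im)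
    (Complex.normSq h - 1) (by rw [hf]; norm_num)
  have e1 : Metric.sphere h 1 =
      {z | circleForm 1 (-2 * h.re) (-2 * h.im) (Complex.normSq h - 1) z = 0} := by
    ext z
    rw [mem_sphere_iff_norm, Set.mem_ofPred_eq, hf]
    constructor
    · intro h'; rw [h']; norm_num
    · intro h'
      have := norm_nonneg (z - h)
      nlinarith
  have e2 : {z : ℂ | ‖z - h‖ ≤ 1} =
      {z | circleForm 1 (-2 * h.re) (-2 * h.im) (Complex.normSq h - 1) z ≤ 0} := by
    ext z
    rw [Set.mem_ofPred_eq, Set.mem_ofPred_eq, hf]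
    constructor <;> intro h' <;> nlinarith [norm_nonneg (z - h)]
  rw [e1, e2, key]

theorem straightLine_eq (φ : ℝ) :
    straightLine φ = {z | z.re * Real.sin φ - z.im * Real.cos φ = 0} := by
  ext z
  constructor
  · rintro ⟨t, rfl⟩
    simp [Complex.exp_ofReal_mul_I_re, Complex.exp_ofReal_mul_I_im]
    ring
  · intro hz
    have hz' : z.re * Real.sin φ - z.im * Real.cos φ = 0 := hz
    have h1 := Real.sin_sq_add_cos_sq φ
    refine ⟨z.re * Real.cos φ + z.im * Real.sin φ, ?_⟩
    apply Complex.ext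
    · rw [Complex.re_ofReal_mul, Complex.exp_ofReal_mul_I_re]
      linear_combination (-z.re) * h1 + Real.sin φ * hz'
    · rw [Complex.im_ofReal_mul, Complex.exp_ofReal_mul_I_im]
      linear_combination (-z.im) * h1 - Real.cos φ * hz'

theorem closedSide_straightLine_of_neg {φ : ℝ} {h : ℂ}
    (hh : h.re * Real.sin φ - h.im * Real.cos φ < 0) :
    closedSide (straightLine φ) h = {z | z.re * Real.sin φ - z.im * Real.cos φ ≤ 0} := by
  have hf : ∀ z, circleForm 0 (Real.sin φ) (-Real.cos φ) 0 z =
      z.re * Real.sin φ - z.im * Real.cos φ := by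
    intro z; unfold circleForm; ring
  have key := closedSide_circleForm_of_nonneg (p := h) le_rfl (Real.sin φ) (-Real.cos φ) 0
    (by rwa [hf])
  simp only [hf] at key
  rw [straightLine_eq, key]

theorem closedSide_straightLine_of_pos {φ : ℝ} {h : ℂ}
    (hh : 0 < h.re * Real.sin φ - h.im * Real.cos φ) :
    closedSide (straightLine φ) h = {z | 0 ≤ z.re * Real.sin φ - z.im * Real.cos φ} := by
  have hf : ∀ z, circleForm 0 (-Real.sin φ) (Real.cos φ) 0 z =
      -(z.re * Real.sin φ - z.im * Real.cos φ) := by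
    intro z; unfold circleForm; ring
  have key := closedSide_circleForm_of_nonneg (p := h) le_rfl (-Real.sin φ) (Real.cos φ) 0
    (by rw [hf]; linarith)
  simp only [hf, neg_eq_zero, Left.neg_nonpos_iff] at key
  rw [straightLine_eq, key]

/-! ### Products of sines for a power of two -/

open Polynomial in
/-- The powers `ζ^0, …, ζ^M` of a primitive `2M`-th root of unity, `M` a power of two, satisfy no
rational relation that is antisymmetric under `k ↦ M - k`. -/
theorem coeff_eq_zero_of_antisymm {lam M : ℕ} (hM : M = 2 ^ lam) {ζ : ℂ}
    (hζ : IsPrimitiveRoot ζ (2 * M)) (P : ℚ[X]) (hdeg : P.natDegree ≤ M)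
    (hanti : P.coeff M = -P.coeff 0) (hroot : aeval ζ P = 0) : P = 0 := by
  -- Here the 2M-th cyclotomic polynomial is X^M + 1, whose end coefficients are equal; an
  -- antisymmetric multiple of it by a constant must vanish.
  have hcyc : minpoly ℚ ζ = X ^ M + 1 := by
    rw [← cyclotomic_eq_minpoly_rat hζ (by rw [hM]; positivity), hM,
      show 2 * 2 ^ lam = 2 ^ (lam + 1) by ring,
      cyclotomic_prime_pow_eq_geom_sum Nat.prime_two]
    simp [Finset.sum_range_succ, add_comm]
  have hM0 : 0 < M := by rw [hM]; positivity
  have hζM : aeval ζ (X ^ M + 1 : ℚ[X]) = 0 := by rw [← hcyc]; exact minpoly.aeval _ _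
  set Q : ℚ[X] := P - C (P.coeff M) * (X ^ M + 1) with hQ
  have hdX : (X ^ M + 1 : ℚ[X]).natDegree = M := by
    have := natDegree_X_pow_add_C (R := ℚ) (n := M) (r := 1)
    simpa using this
  have hQroot : aeval ζ Q = 0 := by
    rw [hQ, map_sub, map_mul, hroot, hζM, mul_zero, sub_zero]
  have hQcoeff : Q.coeff M = 0 := by
    simp [hQ, coeff_one, hM0.ne']
  have hQdeg : Q.natDegree ≤ M := by
    refine (natDegree_sub_le _ _).trans (max_le hdeg ?_)
    refine (natDegree_C_mul_le _ _).trans hdX.le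
  have hQ0 : Q = 0 := by
    by_contra hne
    have h1 := minpoly.degree_le_of_ne_zero ℚ ζ hne hQroot
    rw [hcyc] at h1
    have h2 := natDegree_le_natDegree h1
    rw [hdX] at h2
    have h3 : Q.natDegree = M := le_antisymm hQdeg h2
    exact hne (leadingCoeff_eq_zero.mp (by rw [leadingCoeff, h3, hQcoeff]))
  have hP : P = C (P.coeff M) * (X ^ M + 1) := sub_eq_zero.mp hQ0
  have h0 : P.coeff 0 = P.coeff M := by
    conv_lhs => rw [hP]
    simp [coeff_X_pow, hM0.ne]
  have : P.coeff M = 0 := by linarith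
  rw [hP, this]; simp

open Polynomial in
-- Since ζ^M = -1, 2 cos(kπ/M) = ζ^k - ζ^(M-k). The relation becomes an antisymmetric polynomial
-- vanishing at ζ, hence zero, and monomials can be matched. In the last alternative both sides are
-- zero.
theorem cos_relation {lam M : ℕ} (hM : M = 2 ^ lam) {p q r s : ℕ}
    (hp : p ≤ M) (hq : q ≤ M) (hr : r ≤ M) (hs : s ≤ M)
    (h : Real.cos (p * (Real.pi / M)) + Real.cos (s * (Real.pi / M)) =
      Real.cos (q * (Real.pi / M)) + Real.cos (r * (Real.pi / M))) :
    (p = q ∧ s = r) ∨ (p = r ∧ s = q) ∨ (p + s = M ∧ q + r = M) := by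
  have hM0 : 0 < M := by rw [hM]; positivity
  have hMR : (M : ℝ) ≠ 0 := by exact_mod_cast hM0.ne'
  set ζ : ℂ := Complex.exp (2 * Real.pi * Complex.I / ((2 * M : ℕ) : ℂ)) with hζdef
  have hζ : IsPrimitiveRoot ζ (2 * M) := Complex.isPrimitiveRoot_exp _ (by omega)
  have hpow : ∀ k : ℕ, ζ ^ k = Complex.exp ((k * (Real.pi / M) : ℝ) * Complex.I) := by
    intro k
    rw [hζdef, ← Complex.exp_nat_mul]
    congr 1
    push_cast
    field_simp
  have hcos : ∀ k ≤ M, ζ ^ k - ζ ^ (M - k) = ((2 * Real.cos (k * (Real.pi / M)) : ℝ) : ℂ) := by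
    intro k hk
    rw [hpow, hpow]
    have : ((M - k : ℕ) * (Real.pi / M) : ℝ) = Real.pi - k * (Real.pi / M) := by
      rw [Nat.cast_sub hk]; field_simp
    rw [this]
    apply Complex.ext
    · rw [Complex.sub_re, Complex.exp_ofReal_mul_I_re, Complex.exp_ofReal_mul_I_re,
        Real.cos_pi_sub, Complex.ofReal_re]; ring
    · rw [Complex.sub_im, Complex.exp_ofReal_mul_I_im, Complex.exp_ofReal_mul_I_im,
        Real.sin_pi_sub, Complex.ofReal_im]; ring
  set g : ℕ → ℚ[X] := fun k => X ^ k - X ^ (M - k) with hg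
  have hgdeg : ∀ k ≤ M, (g k).natDegree ≤ M := by
    intro k hk
    refine (natDegree_sub_le _ _).trans (max_le ?_ ?_) <;> rw [natDegree_X_pow] <;> omega
  have hgcoeff : ∀ k j, (g k).coeff j = (if j = k then 1 else 0) - (if j = M - k then 1 else 0) := by
    intro k j; simp [hg, coeff_X_pow]
  have hP := coeff_eq_zero_of_antisymm hM hζ (g p + g s - (g q + g r)) ?_ ?_ ?_
  · have hc : ∀ j, (g p + g s - (g q + g r)).coeff j = 0 := by
      intro j; rw [hP]; simp
    simp only [coeff_sub, coeff_add, hgcoeff] at hc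
    have h1 := hc p
    have h2 := hc s
    have h3 := hc q
    have h4 := hc r
    clear hc hP hgdeg hgcoeff hcos hpow h hζ hMR
    clear_value ζ g
    clear hζdef hg g ζ
    grind (splits := 40)
  · refine (natDegree_sub_le _ _).trans (max_le ?_ ?_) <;>
      refine (natDegree_add_le _ _).trans (max_le ?_ ?_) <;> exact hgdeg _ ‹_›
  · simp only [coeff_sub, coeff_add, hgcoeff]
    have key : ∀ k ≤ M, ((if M = k then 1 else 0) - (if M = M - k then 1 else 0) : ℚ) =
        -((if 0 = k then 1 else 0) - (if 0 = M - k then 1 else 0)) := by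
      intro k hk
      have e1 : M = k ↔ 0 = M - k := by omega
      have e2 : M = M - k ↔ 0 = k := by omega
      simp only [e1, e2]; ring
    rw [key p hp, key q hq, key r hr, key s hs]; ring
  · simp only [map_sub, map_add, hg, map_pow, aeval_X]
    rw [hcos p hp, hcos q hq, hcos r hr, hcos s hs]
    rw [← Complex.ofReal_add, ← Complex.ofReal_add, ← Complex.ofReal_sub]
    norm_cast
    linarith

/-- Products of two sines of angles `kπ/M`, `1 ≤ k ≤ M/2`, determine the two angles when `M` is a
power of two. -/
theorem sin_mul_sin_unique {lam M : ℕ} (hM : M = 2 ^ lam) {a b c d : ℕ}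
    (ha : 1 ≤ a) (hb : 1 ≤ b) (hc : 1 ≤ c) (hd : 1 ≤ d)
    (ha' : 2 * a ≤ M) (hb' : 2 * b ≤ M) (hc' : 2 * c ≤ M) (hd' : 2 * d ≤ M)
    (h : Real.sin (a * (Real.pi / M)) * Real.sin (d * (Real.pi / M)) =
      Real.sin (b * (Real.pi / M)) * Real.sin (c * (Real.pi / M))) :
    (a = b ∧ d = c) ∨ (a = c ∧ d = b) := by
  have habs : ∀ m n : ℕ, Real.cos (((m - n : ℤ).natAbs : ℕ) * (Real.pi / M)) =
      Real.cos (m * (Real.pi / M) - n * (Real.pi / M)) := by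
    intro m n
    rw [← sub_mul, Nat.cast_natAbs]
    push_cast
    rcases abs_choice ((m : ℝ) - n) with h | h <;> rw [h]
    rw [neg_mul, Real.cos_neg]
  have hadd : ∀ m n : ℕ, Real.cos ((m + n : ℕ) * (Real.pi / M)) =
      Real.cos (m * (Real.pi / M) + n * (Real.pi / M)) := by
    intro m n; push_cast; rw [add_mul]
  -- Product-to-sum, with terms moved so that each side is a sum of two cosines. Of the
  -- alternatives, |a - d| = a + d is impossible, and the zero-sum one forces the larger entry of
  -- each pair to be M/2.
  have := cos_relation hM (p := (a - d : ℤ).natAbs) (s := b + c) (q := (b - c : ℤ).natAbs)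
    (r := a + d) (by omega) (by omega) (by omega) (by omega) (by
      rw [habs, habs, hadd, hadd, Real.cos_sub, Real.cos_sub, Real.cos_add, Real.cos_add]
      linarith)
  omega

/-! ### Covering a truncated wedge by discs -/

/-- P and Q are oblique coordinates along two rays whose angle has cosine c. By Vieta, B and C on
the second ray are both at distance s from the apex A on the first, so the triangle lies in the disc
of radius s about A. Its section P = A(1 - μ) is μB ≤ Q ≤ μC. -/
theorem dist_apex_le {s c P Q A B C : ℝ} (hA : 0 < A) (hC : 0 < C)
    (hsum : C + B = 2 * c * A) (hprod : C * B = A ^ 2 - s ^ 2) (hP : 0 ≤ P) (hQ : 0 ≤ Q)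
    (h1 : A * B ≤ P * B + Q * A) (h2 : P * C + Q * A ≤ A * C) :
    (P - A) ^ 2 + 2 * c * (P - A) * Q + Q ^ 2 ≤ s ^ 2 := by
  obtain ⟨μ, rfl⟩ : ∃ μ, P = A * (1 - μ) := ⟨1 - P / A, by field_simp; ring⟩
  have hμ1 : μ ≤ 1 := by
    by_contra hlt
    have : A * (1 - μ) < 0 := mul_neg_of_pos_of_neg hA (by linarith)
    linarith
  have h1' : μ * B ≤ Q := by
    have : A * (μ * B) ≤ A * Q := by linarith
    exact le_of_mul_le_mul_left this hA
  have h2' : Q ≤ μ * C := by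
    have : A * Q ≤ A * (μ * C) := by linarith
    exact le_of_mul_le_mul_left this hA
  have hμ0 : 0 ≤ μ := nonneg_of_mul_nonneg_left (hQ.trans h2') hC
  have key : (A * (1 - μ) - A) ^ 2 + 2 * c * (A * (1 - μ) - A) * Q + Q ^ 2 =
      (Q - μ * B) * (Q - μ * C) + μ ^ 2 * s ^ 2 := by
    linear_combination (-(μ * Q)) * (-hsum) - μ ^ 2 * hprod
  have hneg : (Q - μ * B) * (Q - μ * C) ≤ 0 :=
    mul_nonpos_of_nonneg_of_nonpos (by linarith) (by linarith)
  have hμ2 : μ ^ 2 ≤ 1 := by nlinarith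
  nlinarith [mul_le_mul_of_nonneg_right hμ2 (sq_nonneg s)]

/-- The triangle has vertices Q = c, P = 1 and Q = 1/c on the two rays. The last two are at
distances s and s²/c ≤ s from the first. In the proof, R and s q are the orthogonal coordinates
about that vertex. -/
theorem dist_corner_le {s c P Q : ℝ} (hs : 0 < s) (hsc : s ≤ c) (h1 : s ^ 2 + c ^ 2 = 1)
    (hP : 0 ≤ P) (hb : c ≤ Q + P * c) (ht : P + Q * c ≤ 1) :
    (Q - c) ^ 2 + 2 * c * (Q - c) * P + P ^ 2 ≤ s ^ 2 := by
  have hc : 0 < c := hs.trans_le hsc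
  obtain ⟨q, rfl⟩ : ∃ q, Q = c + q := ⟨Q - c, by ring⟩
  obtain ⟨R, rfl⟩ : ∃ R, P = R - q * c := ⟨P + q * c, by ring⟩
  have hR : R ≤ s ^ 2 := by linarith
  have hRq : 0 ≤ R * c + q * s ^ 2 := by
    have : R * c + q * s ^ 2 = c + q + (R - q * c) * c - c := by
      linear_combination q * h1
    linarith
  have hval : (c + q - c) ^ 2 + 2 * c * (c + q - c) * (R - q * c) + (R - q * c) ^ 2 =
      R ^ 2 + s ^ 2 * q ^ 2 := by
    linear_combination (-q ^ 2) * h1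
  rw [hval]
  have hs2 : 0 < s ^ 2 := by positivity
  have hsc2 : s ^ 2 ≤ c ^ 2 := pow_le_pow_left₀ hs.le hsc 2
  rcases le_total 0 q with hq | hq
  · have hR0 : 0 ≤ R := by nlinarith
    have hqR : (q * c) ^ 2 ≤ R ^ 2 := pow_le_pow_left₀ (by positivity) (by linarith) 2
    have hRs : R ^ 2 ≤ (s ^ 2) ^ 2 := pow_le_pow_left₀ hR0 hR 2
    have : s ^ 2 * q ^ 2 ≤ c ^ 2 * q ^ 2 := mul_le_mul_of_nonneg_right hsc2 (sq_nonneg q)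
    nlinarith
  · have hR0 : 0 ≤ R := by
      by_contra hlt
      nlinarith
    have hRs : R ^ 2 ≤ (s ^ 2) ^ 2 := pow_le_pow_left₀ hR0 hR 2
    have hqs : (-q * s ^ 2) ^ 2 ≤ (R * c) ^ 2 :=
      pow_le_pow_left₀ (mul_nonneg (by linarith) hs2.le) (by linarith) 2
    have : s ^ 2 * (s ^ 2 * q ^ 2) ≤ s ^ 2 * (s ^ 2 * c ^ 2) := by nlinarith [sq_nonneg c]
    have := le_of_mul_le_mul_left this hs2
    nlinarith

/-- With `sin_succ_mul_sin_pred`, the Vieta relations required by `dist_apex_le`: consecutive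
lattice points are at distance sin x. -/
theorem sin_succ_add_sin_pred (x : ℝ) {n : ℕ} (hn : 1 ≤ n) :
    Real.sin ((n + 1 : ℕ) * x) + Real.sin ((n - 1 : ℕ) * x) =
      2 * Real.cos x * Real.sin (n * x) := by
  rw [Nat.cast_sub hn]
  push_cast
  rw [add_mul, sub_mul, one_mul, Real.sin_add, Real.sin_sub]
  ring

theorem sin_succ_mul_sin_pred (x : ℝ) {n : ℕ} (hn : 1 ≤ n) :
    Real.sin ((n + 1 : ℕ) * x) * Real.sin ((n - 1 : ℕ) * x) =
      Real.sin (n * x) ^ 2 - Real.sin x ^ 2 := by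
  rw [Nat.cast_sub hn]
  push_cast
  rw [add_mul, sub_mul, one_mul, Real.sin_add, Real.sin_sub]
  have h1 := Real.sin_sq_add_cos_sq x
  have h2 := Real.sin_sq_add_cos_sq (n * x)
  linear_combination (Real.sin (n * x)) ^ 2 * h1 - (Real.sin x) ^ 2 * h2

section QuarterTurn

variable {x : ℝ} {N : ℕ}

theorem step_pos (hN : N * x = Real.pi / 2) : 0 < x := by
  have : 0 < (N : ℝ) * x := by rw [hN]; positivity
  exact pos_of_mul_pos_right this (Nat.cast_nonneg N)

theorem sin_step_pos (hN : N * x = Real.pi / 2) {n : ℕ} (h0 : 1 ≤ n) (hn : n ≤ N) :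
    0 < Real.sin (n * x) := by
  have hx := step_pos hN
  apply Real.sin_pos_of_pos_of_lt_pi
  · positivity
  · have : (n : ℝ) * x ≤ N * x := by gcongr
    linarith [Real.pi_pos]

theorem sin_step_nonneg (hN : N * x = Real.pi / 2) {n : ℕ} (hn : n ≤ N) :
    0 ≤ Real.sin (n * x) := by
  rcases Nat.eq_zero_or_pos n with rfl | h
  · simp
  · exact (sin_step_pos hN h hn).le

theorem sin_step_le (hN : N * x = Real.pi / 2) {m n : ℕ} (hmn : m ≤ n) (hn : n ≤ N) :
    Real.sin (m * x) ≤ Real.sin (n * x) := by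
  have hx := step_pos hN
  have h1 : (m : ℝ) * x ≤ n * x := by gcongr
  have h2 : (n : ℝ) * x ≤ N * x := by gcongr
  have h3 : 0 ≤ (m : ℝ) * x := by positivity
  exact Real.sin_le_sin_of_le_of_le_pi_div_two (by linarith [Real.pi_pos]) (by linarith) h1

theorem sin_pred_quarter (hN : N * x = Real.pi / 2) (h1 : 1 ≤ N) :
    Real.sin ((N - 1 : ℕ) * x) = Real.cos x := by
  rw [Nat.cast_sub h1, sub_mul, hN, Nat.cast_one, one_mul, Real.sin_pi_div_two_sub]

theorem sin_le_cos_step (hN : N * x = Real.pi / 2) (h2 : 2 ≤ N) : Real.sin x ≤ Real.cos x := by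
  rw [← sin_pred_quarter hN (by omega)]
  simpa using sin_step_le hN (m := 1) (n := N - 1) (by omega) (by omega)

/-- The edge joining the `k`-th and the `k + 1`-st lattice point, one of them on each ray of a
wedge of angle `x`; `Beyond` is the closed side away from the origin. -/
def Beyond (x : ℝ) (e : ℕ) (P Q : ℝ) (k : ℕ) : Prop :=
  if Odd (k + e) then
    Real.sin (k * x) * Real.sin ((k + 1 : ℕ) * x) ≤
      P * Real.sin ((k + 1 : ℕ) * x) + Q * Real.sin (k * x)
  else
    Real.sin (k * x) * Real.sin ((k + 1 : ℕ) * x) ≤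
      Q * Real.sin ((k + 1 : ℕ) * x) + P * Real.sin (k * x)

/-- A half wedge of angle `x` is covered by the discs of radius `sin x` about the points at
distance `sin (n x)` from the origin, alternately on its two sides. -/
theorem half_wedge_cover (hN : N * x = Real.pi / 2) (hN2 : 2 ≤ N) (hNe : Even N) {e : ℕ}
    (he : e = 0 ∨ e = 1) {P Q : ℝ} (hP : 0 ≤ P) (hQ : 0 ≤ Q)
    (hPQ : P + Q * Real.cos x ≤ Real.sin ((N - 1 + e : ℕ) * x)) :
    ∃ n ≤ N, 1 ≤ n ∧
      ((Odd (n + e) ∧ (P - Real.sin (n * x)) ^ 2 + 2 * Real.cos x * (P - Real.sin (n * x)) * Q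
        + Q ^ 2 ≤ Real.sin x ^ 2) ∨
      (Even (n + e) ∧ (Q - Real.sin (n * x)) ^ 2 + 2 * Real.cos x * (Q - Real.sin (n * x)) * P
        + P ^ 2 ≤ Real.sin x ^ 2)) := by
  have hN1 : Real.sin (N * x) = 1 := by rw [hN, Real.sin_pi_div_two]
  -- The edges cut the half wedge into triangles with apex at the successive lattice points; the
  -- first edge not passed singles out the triangle. If all are passed, the truncation bound takes
  -- over.
  by_cases hall : ∀ k < N, Beyond x e P Q k
  · have hb := hall (N - 1) (by omega)
    have hb' := hall (N - 2) (by omega)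
    refine ⟨N - 1, by omega, by omega, ?_⟩
    rcases he with rfl | rfl
    -- For e = 0 the truncation line is the last edge itself, from distance cos x on the P-ray to
    -- distance 1 on the Q-ray.
    · left
      have hodd : Odd (N - 1 + 0) := by grind
      have hnodd : ¬ Odd (N - 2 + 0) := by grind
      refine ⟨hodd, ?_⟩
      rw [Beyond, if_neg hnodd] at hb'
      have hnn : N - 2 + 1 = N - 1 := by omega
      rw [hnn] at hb'
      refine dist_apex_le (B := Real.sin ((N - 1 - 1 : ℕ) * x))
        (C := Real.sin ((N - 1 + 1 : ℕ) * x))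
        (sin_step_pos hN (by omega) (by omega)) (sin_step_pos hN (by omega) (by omega))
        (sin_succ_add_sin_pred x (by omega)) (sin_succ_mul_sin_pred x (by omega)) hP hQ ?_ ?_
      · rw [show N - 1 - 1 = N - 2 by omega]
        linarith
      · rw [show N - 1 + 1 = N by omega, hN1, sin_pred_quarter hN (by omega)]
        rw [add_zero, sin_pred_quarter hN (by omega)] at hPQ
        linarith
    -- For e = 1 the truncation line is the perpendicular at distance 1 on the P-ray, which leaves a
    -- corner triangle past the last edge.
    · right
      have hev : Even (N - 1 + 1) := by grind
      refine ⟨hev, ?_⟩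
      rw [Beyond, if_neg (by simpa using hev), show N - 1 + 1 = N by omega, hN1,
        sin_pred_quarter hN (by omega)] at hb
      rw [show N - 1 + 1 = N by omega, hN1] at hPQ
      rw [sin_pred_quarter hN (by omega)]
      refine dist_corner_le ?_ (sin_le_cos_step hN hN2) (Real.sin_sq_add_cos_sq x) hP
        (by linarith) hPQ
      simpa using sin_step_pos hN (n := 1) le_rfl (by omega)
  · push Not at hall
    classical
    have hex : ∃ k, k < N ∧ ¬ Beyond x e P Q k := hall
    obtain ⟨hkN, hk⟩ := Nat.find_spec hex
    set k := Nat.find hex with hkdef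
    -- Edge 0 starts at the origin and runs along a ray, so every point of the half wedge is beyond
    -- it.
    have hk1 : 1 ≤ k := by
      by_contra h0
      have h00 : k = 0 := by omega
      apply hk
      rw [h00]
      have := sin_step_pos hN (n := 1) le_rfl (by omega)
      unfold Beyond
      have hs : 0 ≤ Real.sin x := by simpa using this.le
      split_ifs <;> simp <;> positivity
    have hprev : Beyond x e P Q (k - 1) := by
      by_contra hn
      have := Nat.find_min hex (m := k - 1) (by omega)
      exact this ⟨by omega, hn⟩
    have hA := sin_step_pos hN hk1 hkN.le
    have hC := sin_step_pos hN (n := k + 1) (by omega) (by omega)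
    refine ⟨k, hkN.le, hk1, ?_⟩
    unfold Beyond at hk hprev
    rw [show k - 1 + 1 = k by omega] at hprev
    by_cases hodd : Odd (k + e)
    · left
      refine ⟨hodd, ?_⟩
      rw [if_pos hodd] at hk
      rw [if_neg (by grind)] at hprev
      exact dist_apex_le hA hC (sin_succ_add_sin_pred x hk1) (sin_succ_mul_sin_pred x hk1) hP hQ
        (by linarith) (by linarith)
    · right
      refine ⟨by simpa using hodd, ?_⟩
      rw [if_neg hodd] at hk
      rw [if_pos (by grind)] at hprev
      exact dist_apex_le hA hC (sin_succ_add_sin_pred x hk1) (sin_succ_mul_sin_pred x hk1) hQ hP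
        (by linarith) (by linarith)

theorem wedge_cover (hN : N * x = Real.pi / 2) (hN2 : 2 ≤ N) (hNe : Even N) {e : ℕ}
    (he : e = 0 ∨ e = 1) {U V : ℝ} (hV : |V| * Real.cos x ≤ U * Real.sin x)
    (hU : Real.sin x * U ≤ Real.sin ((N - 1 + e : ℕ) * x)) :
    ∃ n ≤ N, 1 ≤ n ∧ ∃ p : ℤ, (p = 0 ∨ p = 1 ∨ p = -1) ∧ Odd ((n : ℤ) + e + p) ∧
      (Real.sin x * U - Real.sin (n * x) * Real.cos (p * x)) ^ 2 +
        (Real.sin x * V - Real.sin (n * x) * Real.sin (p * x)) ^ 2 ≤ Real.sin x ^ 2 := by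
  -- Oblique coordinates of sin x · (U + j|V|), after folding the wedge along its axis; the sign of
  -- V later selects p = 1 or p = -1.
  obtain ⟨n, hn, hn1, h⟩ := half_wedge_cover hN hN2 hNe he (P := Real.sin x * U - |V| * Real.cos x)
    (by linarith) (abs_nonneg V) (by linarith)
  have h1 := Real.sin_sq_add_cos_sq x
  have hVV := sq_abs V
  refine ⟨n, hn, hn1, ?_⟩
  rcases h with ⟨ho, h⟩ | ⟨ho, h⟩
  · refine ⟨0, Or.inl rfl, by rw [add_zero]; exact_mod_cast ho, ?_⟩
    refine le_trans (le_of_eq ?_) h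
    simp only [Int.cast_zero, zero_mul, Real.cos_zero, Real.sin_zero]
    linear_combination (- Real.sin x ^ 2) * hVV + |V| ^ 2 * h1
  · have hodd : ∀ p : ℤ, p = 1 ∨ p = -1 → Odd ((n : ℤ) + e + p) := by
      have : Even ((n : ℤ) + e) := by exact_mod_cast ho
      intro p hp
      rcases hp with rfl | rfl
      · exact this.add_one
      · exact this.add_odd (by decide)
    rcases le_total 0 V with hV0 | hV0
    · refine ⟨1, by simp, hodd 1 (by simp), le_trans (le_of_eq ?_) h⟩
      rw [abs_of_nonneg hV0]
      simp only [Int.cast_one, one_mul]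
      linear_combination (Real.sin (n * x) ^ 2 + V ^ 2 - 2 * V * Real.sin (n*x)) * h1
    · refine ⟨-1, by simp, hodd (-1) (by simp), le_trans (le_of_eq ?_) h⟩
      rw [abs_of_nonpos hV0]
      simp only [Int.cast_neg, Int.cast_one, neg_mul, one_mul, Real.cos_neg, Real.sin_neg]
      linear_combination (Real.sin (n * x) ^ 2 + V ^ 2 + 2 * V * Real.sin (n*x)) * h1

end QuarterTurn

/-! ### Polar form of the difference constellation -/

/-- The unit complex number with phase angle `kπ/M`. -/
noncomputable def unitPhase (M : ℕ) (k : ℤ) : ℂ :=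
  Complex.exp ((k * (Real.pi / M) : ℝ) * Complex.I)

theorem unitPhase_re (M : ℕ) (k : ℤ) : (unitPhase M k).re = Real.cos (k * (Real.pi / M)) :=
  Complex.exp_ofReal_mul_I_re _

theorem unitPhase_im (M : ℕ) (k : ℤ) : (unitPhase M k).im = Real.sin (k * (Real.pi / M)) :=
  Complex.exp_ofReal_mul_I_im _

theorem norm_unitPhase (M : ℕ) (k : ℤ) : ‖unitPhase M k‖ = 1 :=
  Complex.norm_exp_ofReal_mul_I _

theorem unitPhase_ne_zero (M : ℕ) (k : ℤ) : unitPhase M k ≠ 0 := Complex.exp_ne_zero _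

theorem unitPhase_zero (M : ℕ) : unitPhase M 0 = 1 := by simp [unitPhase]

theorem unitPhase_add (M : ℕ) (j k : ℤ) : unitPhase M (j + k) = unitPhase M j * unitPhase M k := by
  unfold unitPhase
  rw [← Complex.exp_add]
  congr 1
  push_cast
  ring

theorem conj_unitPhase (M : ℕ) (k : ℤ) :
    (starRingEnd ℂ) (unitPhase M k) = unitPhase M (-k) := by
  apply Complex.ext
  · rw [Complex.conj_re, unitPhase_re, unitPhase_re]; push_cast; rw [neg_mul, Real.cos_neg]
  · rw [Complex.conj_im, unitPhase_im, unitPhase_im]; push_cast; rw [neg_mul, Real.sin_neg]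

theorem unitPhase_self {M : ℕ} (hM : M ≠ 0) : unitPhase M M = -1 := by
  have hMR : (M : ℝ) ≠ 0 := by exact_mod_cast hM
  have : ((M : ℤ) : ℝ) * (Real.pi / M) = Real.pi := by push_cast; field_simp
  unfold unitPhase
  rw [this, Complex.exp_pi_mul_I]

theorem unitPhase_add_self {M : ℕ} (hM : M ≠ 0) (k : ℤ) : unitPhase M (k + M) = -unitPhase M k := by
  rw [unitPhase_add, unitPhase_self hM, mul_neg_one]

theorem unitPhase_add_mul_two_self {M : ℕ} (hM : M ≠ 0) (k t : ℤ) :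
    unitPhase M (k + 2 * M * t) = unitPhase M k := by
  induction t using Int.induction_on with
  | zero => simp
  | succ i ih =>
    rw [show k + 2 * M * ((i : ℤ) + 1) = k + 2 * M * i + M + M by ring, unitPhase_add_self hM,
      unitPhase_add_self hM, neg_neg, ih]
  | pred i ih =>
    rw [← ih, show k + 2 * M * (-(i : ℤ)) = k + 2 * M * (-(i : ℤ) - 1) + M + M by ring,
      unitPhase_add_self hM, unitPhase_add_self hM, neg_neg]

theorem unitPhase_mem_psk {M : ℕ} (hM : M ≠ 0) (k : ℤ) : unitPhase M (2 * k + 1) ∈ psk M := by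
  have hMZ : (0 : ℤ) < M := by exact_mod_cast Nat.pos_of_ne_zero hM
  have h0 := Int.emod_nonneg k hMZ.ne'
  have h1 := Int.emod_lt_of_pos k hMZ
  refine ⟨(k % M).toNat, by omega, ?_⟩
  have hk : 2 * k + 1 = 2 * (k % M) + 1 + 2 * M * (k / M) := by
    have := Int.emod_add_mul_ediv k M
    linear_combination (-2) * this
  rw [hk, unitPhase_add_mul_two_self hM, unitPhase]
  have : (((k % M).toNat : ℕ) : ℝ) = ((k % M : ℤ) : ℝ) := by
    rw [← Int.cast_natCast, Int.toNat_of_nonneg h0]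
  rw [this]
  congr 3
  push_cast
  ring

theorem mem_psk_iff {M : ℕ} (hM : M ≠ 0) (s : ℂ) : s ∈ psk M ↔ ∃ k : ℤ, s = unitPhase M (2 * k + 1) := by
  constructor
  · rintro ⟨k, -, rfl⟩
    refine ⟨k, ?_⟩
    unfold unitPhase
    congr 3
    push_cast
    ring
  · rintro ⟨k, rfl⟩
    exact unitPhase_mem_psk hM k

/-- The point `2 sin(nπ/M)` at phase angle `mπ/M`. -/
noncomputable def diffPoint (M : ℕ) (n m : ℤ) : ℂ :=
  ((2 * Real.sin (n * (Real.pi / M)) : ℝ) : ℂ) * unitPhase M m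

theorem unitPhase_sub_unitPhase {K : ℕ} (hK : K ≠ 0) (i j : ℤ) :
    unitPhase (2 * K) (2 * i + 1) - unitPhase (2 * K) (2 * j + 1) =
      diffPoint (2 * K) (i - j) (i + j + 1 + K) := by
  have hKR : (K : ℝ) ≠ 0 := by exact_mod_cast hK
  set y : ℝ := Real.pi / ((2 * K : ℕ) : ℝ) with hy
  have hKy : (K : ℝ) * y = Real.pi / 2 := by rw [hy]; push_cast; field_simp
  have hI : unitPhase (2 * K) K = Complex.I := by
    apply Complex.ext
    · rw [unitPhase_re, Int.cast_natCast, hKy, Real.cos_pi_div_two, Complex.I_re]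
    · rw [unitPhase_im, Int.cast_natCast, hKy, Real.sin_pi_div_two, Complex.I_im]
  have hs : ((2 * Real.sin ((i - j : ℤ) * y) : ℝ) : ℂ) * Complex.I =
      unitPhase (2 * K) (i - j) - unitPhase (2 * K) (j - i) := by
    have hn : (((j - i : ℤ) : ℝ) * y) = -(((i - j : ℤ) : ℝ) * y) := by push_cast; ring
    apply Complex.ext
    · rw [Complex.re_ofReal_mul, Complex.I_re, Complex.sub_re, unitPhase_re, unitPhase_re, ← hy, hn,
        Real.cos_neg]
      ring
    · rw [Complex.im_ofReal_mul, Complex.I_im, Complex.sub_im, unitPhase_im, unitPhase_im, ← hy, hn,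
        Real.sin_neg]
      ring
  rw [diffPoint, unitPhase_add _ _ (K : ℤ), hI, mul_comm (unitPhase _ _) Complex.I, ← mul_assoc, hs, sub_mul,
    ← unitPhase_add, ← unitPhase_add]
  congr 2 <;> ring

/-- The difference constellation consists of the points `2 sin(nπ/M) e^{jmπ/M}` with `n + m` odd. -/
theorem mem_diffConstellation_iff {M : ℕ} (hM : M ≠ 0) (h4 : 4 ∣ M) (d : ℂ) :
    d ∈ diffConstellation M ↔ ∃ n m : ℤ, Odd (n + m) ∧ d = diffPoint M n m := by
  obtain ⟨L, rfl⟩ := h4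
  have e : 4 * L = 2 * (2 * L) := by ring
  have hK : 2 * L ≠ 0 := by omega
  constructor
  · rintro ⟨s, hs, s', hs', rfl⟩
    obtain ⟨i, rfl⟩ := (mem_psk_iff hM s).mp hs
    obtain ⟨j, rfl⟩ := (mem_psk_iff hM s').mp hs'
    -- The quarter turn M/2 = 2L is even because 4 divides M, which keeps n + m odd.
    refine ⟨i - j, i + j + 1 + (2 * L : ℕ), ⟨i + L, by push_cast; ring⟩, ?_⟩
    rw [e, unitPhase_sub_unitPhase hK]
  · rintro ⟨n, m, ⟨t, ht⟩, rfl⟩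
    refine ⟨unitPhase (4 * L) (2 * (t - L) + 1), unitPhase_mem_psk hM _,
      unitPhase (4 * L) (2 * (t - L - n) + 1), unitPhase_mem_psk hM _, ?_⟩
    rw [e, unitPhase_sub_unitPhase hK]
    congr 1
    · ring
    · push_cast
      linear_combination ht

theorem diffPoint_neg (M : ℕ) (hM : M ≠ 0) (n m : ℤ) : diffPoint M (-n) m = diffPoint M n (m + M) := by
  unfold diffPoint
  rw [unitPhase_add_self hM]
  push_cast
  rw [neg_mul, Complex.sin_neg]
  ring

theorem diffPoint_add_self (M : ℕ) (hM : M ≠ 0) (n m : ℤ) :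
    diffPoint M (n + M) m = diffPoint M n (m + M) := by
  have hMR : (M : ℝ) ≠ 0 := by exact_mod_cast hM
  have : ((n + M : ℤ) : ℝ) * (Real.pi / M) = n * (Real.pi / M) + Real.pi := by push_cast; field_simp
  unfold diffPoint
  rw [unitPhase_add_self hM, this, Real.sin_add_pi]
  push_cast
  ring

theorem exists_diffPoint_of_mem {M : ℕ} (hM : M ≠ 0) (h4 : 4 ∣ M) {d : ℂ}
    (hd : d ∈ diffConstellation M) :
    ∃ (n : ℕ) (m : ℤ), 2 * n ≤ M ∧ Odd (n + m) ∧ d = diffPoint M n m := by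
  obtain ⟨n, m, ho, rfl⟩ := (mem_diffConstellation_iff hM h4 d).mp hd
  have hMe : Even (M : ℤ) := by
    obtain ⟨L, rfl⟩ := h4
    exact ⟨2 * L, by push_cast; ring⟩
  have hMZ : (0 : ℤ) < M := by exact_mod_cast Nat.pos_of_ne_zero hM
  -- Shifting n by M changes the sign of the sine, which a half turn of the phase undoes. After
  -- reduction modulo M, the reflection r ↦ M - r brings n to at most M/2.
  have hshift : ∀ t : ℤ, ∀ n : ℤ, ∃ m' : ℤ, (Odd (n + m) → Odd (n + t * M + m')) ∧
      diffPoint M n m = diffPoint M (n + t * M) m' := by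
    intro t n
    induction t using Int.induction_on with
    | zero => exact ⟨m, by simp, by simp⟩
    | succ i ih =>
      obtain ⟨m', h1, h2⟩ := ih
      refine ⟨m' - M, fun h => ?_, ?_⟩
      · have := h1 h; rw [show n + ((i : ℤ) + 1) * M + (m' - M) = n + i * M + m' by ring]; exact this
      · rw [h2, show n + ((i : ℤ) + 1) * M = n + i * M + M by ring, diffPoint_add_self M hM,
          sub_add_cancel]
    | pred i ih =>
      obtain ⟨m', h1, h2⟩ := ih
      refine ⟨m' + M, fun h => ?_, ?_⟩
      · have := h1 h
        rw [show n + (-(i : ℤ) - 1) * M + (m' + M) = n + -(i : ℤ) * M + m' by ring]; exact this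
      · rw [h2, ← diffPoint_add_self M hM]
        congr 1
        ring
  obtain ⟨m', h1, h2⟩ := hshift (-(n / M)) n
  have hmod : n + -(n / M) * M = n % M := by
    have := Int.emod_add_mul_ediv n M
    linear_combination (-1) * this
  rw [hmod] at h1 h2
  have hr0 := Int.emod_nonneg n hMZ.ne'
  have hr1 := Int.emod_lt_of_pos n hMZ
  have h1' := h1 ho
  set r := n % M
  by_cases hr : 2 * r ≤ M
  · refine ⟨r.toNat, m', by omega, ?_, ?_⟩ <;> rw [Int.toNat_of_nonneg hr0]
    · exact h1'
    · exact h2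
  · refine ⟨(M - r).toNat, m', by omega, ?_, ?_⟩ <;> rw [Int.toNat_of_nonneg (by omega)]
    · rw [show (M : ℤ) - r + m' = r + m' + M - 2 * r by ring]
      exact (h1'.add_even hMe).sub_even (even_two_mul r)
    · rw [h2, show (M : ℤ) - r = -r + M by ring, diffPoint_add_self M hM, diffPoint_neg M hM,
        show m' + M + M = m' + 2 * M * 1 by ring]
      unfold diffPoint
      rw [unitPhase_add_mul_two_self hM]

theorem diffPoint_mem {M : ℕ} (hM : M ≠ 0) (h4 : 4 ∣ M) {n m : ℤ} (h : Odd (n + m)) :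
    diffPoint M n m ∈ diffConstellation M :=
  (mem_diffConstellation_iff hM h4 _).mpr ⟨n, m, h, rfl⟩

theorem conj_diffPoint (M : ℕ) (n m : ℤ) :
    (starRingEnd ℂ) (diffPoint M n m) = diffPoint M n (-m) := by
  unfold diffPoint
  rw [map_mul, Complex.conj_ofReal, conj_unitPhase]

theorem conj_mem_diffConstellation {M : ℕ} (hM : M ≠ 0) (h4 : 4 ∣ M) {d : ℂ}
    (hd : d ∈ diffConstellation M) : (starRingEnd ℂ) d ∈ diffConstellation M := by
  obtain ⟨n, m, ho, rfl⟩ := (mem_diffConstellation_iff hM h4 d).mp hd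
  rw [conj_diffPoint]
  refine diffPoint_mem hM h4 ?_
  rw [show n + -m = n + m - 2 * m by ring]
  exact ho.sub_even (even_two_mul m)

theorem diffPoint_mul_unitPhase (M : ℕ) (n m k : ℤ) :
    diffPoint M n m * unitPhase M k = diffPoint M n (m + k) := by
  unfold diffPoint
  rw [unitPhase_add, mul_assoc]

theorem zero_mem_diffConstellation {M : ℕ} (hM : M ≠ 0) (h4 : 4 ∣ M) :
    (0 : ℂ) ∈ diffConstellation M := by
  have := diffPoint_mem hM h4 (n := 0) (m := 1) (by decide)
  simpa [diffPoint] using this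

theorem half_mul_step {M : ℕ} (hM : M ≠ 0) (h4 : 4 ∣ M) :
    ((M / 2 : ℕ) : ℝ) * (Real.pi / M) = Real.pi / 2 := by
  obtain ⟨L, rfl⟩ := h4
  have hL : (L : ℝ) ≠ 0 := by
    have : L ≠ 0 := by omega
    exact_mod_cast this
  rw [show 4 * L / 2 = 2 * L by omega]
  push_cast
  field_simp
  norm_num

theorem sin_pi_div_pos {M : ℕ} (hM : M ≠ 0) (h4 : 4 ∣ M) : 0 < Real.sin (Real.pi / M) := by
  have := sin_step_pos (half_mul_step hM h4) (n := 1) le_rfl (by omega)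
  simpa using this

theorem sin_le_cos_pi_div {M : ℕ} (hM : M ≠ 0) (h4 : 4 ∣ M) :
    Real.sin (Real.pi / M) ≤ Real.cos (Real.pi / M) :=
  sin_le_cos_step (half_mul_step hM h4) (by omega)

theorem cos_pi_div_pos {M : ℕ} (hM : M ≠ 0) (h4 : 4 ∣ M) : 0 < Real.cos (Real.pi / M) :=
  (sin_pi_div_pos hM h4).trans_le (sin_le_cos_pi_div hM h4)

theorem sin_int_mul_eq_zero {M : ℕ} (hM : M ≠ 0) {t : ℤ} (ht : (M : ℤ) ∣ t) :
    Real.sin (t * (Real.pi / M)) = 0 := by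
  obtain ⟨k, rfl⟩ := ht
  have hMR : (M : ℝ) ≠ 0 := by exact_mod_cast hM
  rw [show ((M * k : ℤ) : ℝ) * (Real.pi / M) = k * Real.pi by push_cast; field_simp]
  exact Real.sin_int_mul_pi k

theorem sin_le_abs_sin_int_mul {M : ℕ} (hM : M ≠ 0) (h4 : 4 ∣ M) {t : ℤ} (ht : ¬ (M : ℤ) ∣ t) :
    Real.sin (Real.pi / M) ≤ |Real.sin (t * (Real.pi / M))| := by
  have hMZ : (0 : ℤ) < M := by exact_mod_cast Nat.pos_of_ne_zero hM
  have hMR : (M : ℝ) ≠ 0 := by exact_mod_cast hM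
  have hr0 := Int.emod_nonneg t hMZ.ne'
  have hr1 := Int.emod_lt_of_pos t hMZ
  have hrne : t % M ≠ 0 := fun h => ht (Int.dvd_of_emod_eq_zero h)
  have hdecomp : (t : ℝ) * (Real.pi / M) = (t % M : ℤ) * (Real.pi / M) + (t / M : ℤ) * Real.pi := by
    have h : ((t % M + M * (t / M) : ℤ) : ℝ) = t := by rw [Int.emod_add_mul_ediv]
    rw [← h]
    push_cast
    field_simp
  have habs : |Real.sin (t * (Real.pi / M))| = |Real.sin ((t % M : ℤ) * (Real.pi / M))| := by
    rw [hdecomp, Real.sin_add_int_mul_pi, abs_mul]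
    rcases Int.even_or_odd (t / M) with h | h
    · simp [h.neg_one_zpow]
    · simp [h.neg_one_zpow]
  rw [habs]
  set r := t % M
  have key : ∀ k : ℕ, 1 ≤ k → k ≤ M / 2 → Real.sin (Real.pi / M) ≤ Real.sin (k * (Real.pi / M)) := by
    intro k h1 h2
    have := sin_step_le (half_mul_step hM h4) h1 h2
    simpa using this
  refine le_trans ?_ (le_abs_self _)
  by_cases hr : 2 * r ≤ M
  · have := key r.toNat (by omega) (by omega)
    rwa [show ((r.toNat : ℕ) : ℝ) = r by
      rw [← Int.cast_natCast, Int.toNat_of_nonneg hr0]] at this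
  · have := key (M - r).toNat (by omega) (by omega)
    rw [show (((M - r : ℤ).toNat : ℕ) : ℝ) = ((M - r : ℤ) : ℝ) by
      rw [← Int.cast_natCast, Int.toNat_of_nonneg (by omega)]] at this
    rw [show (((M : ℤ) - r : ℤ) : ℝ) * (Real.pi / M) = Real.pi - r * (Real.pi / M) by
      push_cast; field_simp, Real.sin_pi_sub] at this
    exact this

/-- Among the directions `qπ/M` with `q` of fixed parity, one of `0`, `±π/M` is closest to any
point of the wedge of half-angle `π/M` about the positive real axis. -/
theorem exists_closest_direction {M : ℕ} (hM : M ≠ 0) (h4 : 4 ∣ M) {U V : ℝ}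
    (hUV : |V| * Real.cos (Real.pi / M) ≤ U * Real.sin (Real.pi / M)) (q : ℤ) :
    ∃ q₀ : ℤ, (q₀ = 0 ∨ q₀ = 1 ∨ q₀ = -1) ∧ Even (q₀ - q) ∧
      U * Real.cos (q * (Real.pi / M)) + V * Real.sin (q * (Real.pi / M)) ≤
        U * Real.cos (q₀ * (Real.pi / M)) + V * Real.sin (q₀ * (Real.pi / M)) := by
  have hs := sin_pi_div_pos hM h4
  have hc := cos_pi_div_pos hM h4
  have h1 := Real.sin_sq_add_cos_sq (Real.pi / M)
  set x := Real.pi / M with hx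
  set s := Real.sin x
  set c := Real.cos x
  have hU : 0 ≤ U := nonneg_of_mul_nonneg_left ((mul_nonneg (abs_nonneg V) hc.le).trans hUV) hs
  -- For q = 2t the gain of direction 0 is 2 sin(tx)(U sin(tx) - V cos(tx)), nonnegative in the
  -- wedge because |sin(tx)| ≥ sin x unless M divides t. For odd q that bound holds for sin(qx)
  -- itself, and Cauchy-Schwarz gives the comparison with ±1.
  rcases Int.even_or_odd q with hq | hq
  · refine ⟨0, Or.inl rfl, by simpa using hq, ?_⟩
    obtain ⟨t, rfl⟩ := hq
    simp only [Int.cast_zero, zero_mul, Real.cos_zero, Real.sin_zero, mul_zero, add_zero, mul_one]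
    rw [show ((t + t : ℤ) : ℝ) * x = 2 * (t * x) by push_cast; ring, Real.cos_two_mul,
      Real.sin_two_mul]
    have h2 := Real.sin_sq_add_cos_sq (t * x)
    by_cases ht : (M : ℤ) ∣ t
    · have h0 := sin_int_mul_eq_zero hM ht
      rw [← hx] at h0
      rw [h0] at h2 ⊢
      nlinarith
    · have hσ := sin_le_abs_sin_int_mul hM h4 ht
      rw [← hx] at hσ
      set σ := Real.sin (t * x)
      set κ := Real.cos (t * x)
      have hσ2 : s ^ 2 ≤ σ ^ 2 := by rw [← sq_abs σ]; exact pow_le_pow_left₀ hs.le hσ 2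
      have hκ : |κ| ≤ c := abs_le_of_sq_le_sq (by linarith) hc.le
      have hκ' : |V| * |κ| ≤ U * |σ| :=
        calc |V| * |κ| ≤ |V| * c := by gcongr
          _ ≤ U * s := hUV
          _ ≤ U * |σ| := by gcongr
      have hfin : V * (σ * κ) ≤ U * σ ^ 2 :=
        calc V * (σ * κ) ≤ |V * (σ * κ)| := le_abs_self _
          _ = |σ| * (|V| * |κ|) := by rw [abs_mul, abs_mul]; ring
          _ ≤ |σ| * (U * |σ|) := by gcongr
          _ = U * σ ^ 2 := by rw [← sq_abs σ]; ring
      nlinarith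
  · have hnd : ¬ (M : ℤ) ∣ q := by
      intro hd
      have : (2 : ℤ) ∣ q := Dvd.dvd.trans (by exact_mod_cast (Dvd.dvd.trans (by norm_num) h4)) hd
      rcases hq with ⟨r, rfl⟩
      omega
    have hS := sin_le_abs_sin_int_mul hM h4 hnd
    rw [← hx] at hS
    have h2 := Real.sin_sq_add_cos_sq (q * x)
    set S := Real.sin (q * x)
    set C := Real.cos (q * x)
    have hgen : U * C + V * S ≤ U * c + |V| * s := by
      have hVS : V * S ≤ |V| * |S| := (le_abs_self _).trans (abs_mul V S).le
      have hcs : c * C + s * |S| ≤ 1 := by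
        nlinarith [sq_nonneg (c - C), sq_nonneg (s - |S|), sq_abs S]
      have e1 : c * (|V| * (|S| - s)) ≤ c * (U * (c - C)) := by
        have : |V| * c * (|S| - s) ≤ U * s * (|S| - s) :=
          mul_le_mul_of_nonneg_right hUV (by linarith)
        have : U * (c * C + s * |S|) ≤ U * 1 := by gcongr
        nlinarith
      have := le_of_mul_le_mul_left e1 hc
      linarith
    rcases le_total 0 V with hV | hV
    · refine ⟨1, by simp, by grind, ?_⟩
      rw [abs_of_nonneg hV] at hgen
      simpa using hgen
    · refine ⟨-1, by simp, by grind, ?_⟩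
      rw [abs_of_nonpos hV] at hgen
      simpa using hgen

theorem normSq_sub_mul_unitPhase (M : ℕ) (w : ℂ) (ρ : ℝ) (q : ℤ) :
    Complex.normSq (w - ρ * unitPhase M q) = Complex.normSq w + ρ ^ 2 -
      2 * ρ * (w.re * Real.cos (q * (Real.pi / M)) + w.im * Real.sin (q * (Real.pi / M))) := by
  have h1 := Real.sin_sq_add_cos_sq (q * (Real.pi / M))
  simp only [Complex.normSq_apply, Complex.sub_re, Complex.sub_im, Complex.re_ofReal_mul,
    Complex.im_ofReal_mul, unitPhase_re, unitPhase_im]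
  linear_combination ρ ^ 2 * h1

theorem norm_unitPhase_mul_sub (M : ℕ) (w : ℂ) (ρ : ℝ) (e p : ℤ) :
    ‖unitPhase M e * w - ρ * unitPhase M p‖ = ‖w - ρ * unitPhase M (p - e)‖ := by
  have : unitPhase M e * w - ρ * unitPhase M p = unitPhase M e * (w - ρ * unitPhase M (p - e)) := by
    have h : unitPhase M p = unitPhase M e * unitPhase M (p - e) := by
      rw [← unitPhase_add]; congr 1; ring
    rw [h]; ring
  rw [this, norm_mul, norm_unitPhase, one_mul]

/-! ### Moduli and phases of singular fade states -/

theorem norm_add_mul_eq {h dk dl : ℂ} (hdl : dl ≠ 0) (hh : h = -dk / dl) (z : ℂ) :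
    ‖dk + z * dl‖ = ‖dl‖ * ‖z - h‖ := by
  have : dk + z * dl = dl * (z - h) := by rw [hh]; field_simp; ring
  rw [this, norm_mul]

theorem mem_phaseRay_iff {M : ℕ} (k : ℤ) {α : ℝ} (hα : α = k * (Real.pi / M)) (z : ℂ) :
    z ∈ phaseRay α ↔ z = ‖z‖ * unitPhase M k := by
  constructor
  · rintro ⟨γ, hγ, rfl⟩
    rw [norm_mul, Complex.norm_exp_ofReal_mul_I, mul_one, Complex.norm_real, Real.norm_eq_abs,
      abs_of_nonneg hγ, unitPhase, hα]
  · intro h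
    exact ⟨‖z‖, norm_nonneg z, by rw [hα]; exact h⟩

theorem norm_diffPoint {M : ℕ} (hM : M ≠ 0) (h4 : 4 ∣ M) {n : ℕ} (hn : 2 * n ≤ M) (m : ℤ) :
    ‖diffPoint M n m‖ = 2 * Real.sin (n * (Real.pi / M)) := by
  have := sin_step_nonneg (half_mul_step hM h4) (n := n) (by omega)
  rw [diffPoint, norm_mul, norm_unitPhase, mul_one, Complex.norm_real, Real.norm_eq_abs,
    Int.cast_natCast, abs_of_nonneg (by positivity)]

/-- A nonzero difference in normal form. -/
theorem exists_normal_form {M : ℕ} (hM : M ≠ 0) (h4 : 4 ∣ M) {d : ℂ}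
    (hd : d ∈ diffConstellation M) (hd0 : d ≠ 0) :
    ∃ (n : ℕ) (m : ℤ), 1 ≤ n ∧ 2 * n ≤ M ∧ Odd (n + m) ∧ d = ‖d‖ * unitPhase M m ∧
      ‖d‖ = 2 * Real.sin (n * (Real.pi / M)) := by
  obtain ⟨n, m, hn, ho, rfl⟩ := exists_diffPoint_of_mem hM h4 hd
  refine ⟨n, m, ?_, hn, ho, ?_, norm_diffPoint hM h4 hn m⟩
  · rw [Nat.one_le_iff_ne_zero]
    rintro rfl
    exact hd0 (by simp [diffPoint])
  · rw [norm_diffPoint hM h4 hn m, diffPoint, Int.cast_natCast]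

theorem two_sin_le_norm {M : ℕ} (hM : M ≠ 0) (h4 : 4 ∣ M) {d : ℂ}
    (hd : d ∈ diffConstellation M) (hd0 : d ≠ 0) : 2 * Real.sin (Real.pi / M) ≤ ‖d‖ := by
  obtain ⟨n, m, h1, h2, -, -, hn⟩ := exists_normal_form hM h4 hd hd0
  rw [hn]
  have := sin_step_le (half_mul_step hM h4) h1 (by omega)
  simp only [Nat.cast_one, one_mul] at this
  linarith

theorem ratio_eq {M : ℕ} (hM : M ≠ 0) {dk dl : ℂ} {m m' : ℤ} (hk : dk = ‖dk‖ * unitPhase M m)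
    (hl : dl = ‖dl‖ * unitPhase M m') (hl0 : dl ≠ 0) :
    -dk / dl = ((‖dk‖ / ‖dl‖ : ℝ) : ℂ) * unitPhase M (m - m' + M) := by
  rw [div_eq_iff hl0]
  have hn : ((‖dl‖ : ℝ) : ℂ) ≠ 0 := by simpa using hl0
  have hu : unitPhase M m = unitPhase M (m - m') * unitPhase M m' := by
    rw [← unitPhase_add]; congr 1; ring
  calc -dk = -(‖dk‖ * unitPhase M m) := by rw [← hk]
    _ = ((‖dk‖ / ‖dl‖ : ℝ) : ℂ) * unitPhase M (m - m' + M) * (‖dl‖ * unitPhase M m') := by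
      rw [unitPhase_add_self hM, hu]; push_cast; field_simp
    _ = _ := by rw [← hl]

theorem even_sub_of_unitPhase_eq {M : ℕ} (hM : M ≠ 0) {j k : ℤ} (h : unitPhase M j = unitPhase M k) :
    Even (j - k) := by
  have hMR : (M : ℝ) ≠ 0 := by exact_mod_cast hM
  have h1 : unitPhase M (j - k) = 1 := by
    have : unitPhase M j = unitPhase M (j - k) * unitPhase M k := by
      rw [← unitPhase_add]; congr 1; ring
    rw [h] at this
    exact (mul_eq_right₀ (unitPhase_ne_zero M k)).mp this.symm
  have hcos : Real.cos ((j - k : ℤ) * (Real.pi / M)) = 1 := by rw [← unitPhase_re, h1, Complex.one_re]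
  obtain ⟨t, ht⟩ := (Real.cos_eq_one_iff _).mp hcos
  refine ⟨M * t, ?_⟩
  have : ((j - k : ℤ) : ℝ) = ((M * t + M * t : ℤ) : ℝ) := by
    have hpi := Real.pi_pos.ne'
    field_simp at ht
    push_cast at ht ⊢
    linarith
  exact_mod_cast this

theorem norm_ratio {M : ℕ} {h dk dl : ℂ} (hr : IsRatio M h dk dl) : ‖h‖ * ‖dl‖ = ‖dk‖ := by
  obtain ⟨-, -, h0, rfl⟩ := hr
  rw [norm_div, norm_neg, div_mul_cancel₀ _ (norm_ne_zero_iff.mpr h0)]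

theorem numerator_ne_zero {M : ℕ} {h dk dl : ℂ} (hr : IsRatio M h dk dl) (hh : h ≠ 0) : dk ≠ 0 := by
  rintro rfl
  exact hh (by rw [hr.2.2.2]; simp)

/-- A singular fade state of modulus larger than one determines the moduli of its numerator and
denominator. -/
theorem norm_denominator_unique {lam M : ℕ} (hM : M = 2 ^ lam) (h4 : 4 ∣ M) {h dk dl dk' dl' : ℂ}
    (hr : IsRatio M h dk dl) (hr' : IsRatio M h dk' dl') (hout : 1 < ‖h‖) : ‖dl‖ = ‖dl'‖ := by
  have hM0 : M ≠ 0 := by rw [hM]; positivity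
  have hh : h ≠ 0 := by rintro rfl; norm_num at hout
  have hq := norm_ratio hr
  have hq' := norm_ratio hr'
  obtain ⟨a, -, ha, ha', -, -, hka⟩ := exists_normal_form hM0 h4 hr.1 (numerator_ne_zero hr hh)
  obtain ⟨b, -, hb, hb', -, -, hlb⟩ := exists_normal_form hM0 h4 hr.2.1 hr.2.2.1
  obtain ⟨c, -, hc, hc', -, -, hkc⟩ := exists_normal_form hM0 h4 hr'.1 (numerator_ne_zero hr' hh)
  obtain ⟨d, -, hd, hd', -, -, hld⟩ := exists_normal_form hM0 h4 hr'.2.1 hr'.2.2.1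
  have hprod : ‖dk‖ * ‖dl'‖ = ‖dl‖ * ‖dk'‖ := by rw [← hq, ← hq']; ring
  rw [hka, hlb, hkc, hld] at hprod
  -- The first alternative means |dk| = |dl|, excluded by |h| > 1.
  rcases sin_mul_sin_unique hM ha hb hc hd ha' hb' hc' hd' (by linarith) with ⟨h1, -⟩ | ⟨-, h2⟩
  · exfalso
    have : ‖dk‖ = ‖dl‖ := by rw [hka, hlb, h1]
    have hpos : 0 < ‖dl‖ := norm_pos_iff.mpr hr.2.2.1
    nlinarith
  · rw [hlb, hld, h2]

/-- The largest modulus of a singular fade state with phase angle `eπ/M`. -/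
noncomputable def maxModulus (M e : ℕ) : ℝ :=
  Real.sin ((M / 2 - 1 + e : ℕ) * (Real.pi / M)) / Real.sin (Real.pi / M)

theorem norm_le_maxModulus {M : ℕ} (hM : M ≠ 0) (h4 : 4 ∣ M) {e : ℕ} (he : e = 0 ∨ e = 1)
    {h dk dl : ℂ} (hr : IsRatio M h dk dl) (hray : h = ‖h‖ * unitPhase M e) :
    ‖h‖ ≤ maxModulus M e := by
  have hN := half_mul_step hM h4
  have hs := sin_pi_div_pos hM h4
  have hpos : 0 ≤ maxModulus M e := by
    have := sin_step_nonneg hN (n := M / 2 - 1 + e) (by omega)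
    unfold maxModulus; positivity
  by_cases hh : h = 0
  · rw [hh, norm_zero]; exact hpos
  have hq := norm_ratio hr
  obtain ⟨n, m, hn1, hn, ho, hk, hkn⟩ := exists_normal_form hM h4 hr.1 (numerator_ne_zero hr hh)
  obtain ⟨n', m', hn1', hn', ho', hl, hln⟩ := exists_normal_form hM h4 hr.2.1 hr.2.2.1
  have hlpos : 0 < ‖dl‖ := norm_pos_iff.mpr hr.2.2.1
  have heven : Even ((m - m' + M : ℤ) - e) := by
    apply even_sub_of_unitPhase_eq hM
    have h1 := ratio_eq hM hk hl hr.2.2.1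
    rw [← hr.2.2.2, ← hq, mul_div_cancel_right₀ _ hlpos.ne'] at h1
    rw [hray] at h1
    simp only [norm_mul, Complex.norm_real, norm_norm, norm_unitPhase, mul_one] at h1
    exact (mul_left_cancel₀ (by simpa using hh) h1).symm
  have hval : ‖h‖ = Real.sin (n * (Real.pi / M)) / Real.sin (n' * (Real.pi / M)) := by
    rw [eq_div_iff (sin_step_pos hN hn1' (by omega)).ne']
    rw [hkn, hln] at hq
    linarith
  have hM1 : Real.sin ((M / 2 : ℕ) * (Real.pi / M)) = 1 := by rw [hN, Real.sin_pi_div_two]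
  have hs' : Real.sin (Real.pi / M) ≤ Real.sin (n' * (Real.pi / M)) := by
    simpa using sin_step_le hN hn1' (by omega)
  rw [hval, maxModulus]
  rcases he with rfl | rfl
  -- On the ray of phase 0, n and n' have the same parity. So n' = 1 makes n odd, hence n ≤ M/2 - 1
  -- since M/2 is even. For n' ≥ 2 the modulus is at most 1/sin 2x ≤ cos x/sin x, as 2cos²x ≥ 1.
  · by_cases h1 : n' = 1
    · have hn2 : n ≤ M / 2 - 1 := by
        obtain ⟨L, rfl⟩ := h4
        obtain ⟨i, hi⟩ := ho
        obtain ⟨j, hj⟩ := ho'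
        obtain ⟨k, hk⟩ := heven
        subst h1
        push_cast at *
        omega
      rw [h1, Nat.cast_one, one_mul]
      gcongr
      exact sin_step_le hN (by omega) (by omega)
    · have h2 : Real.sin (2 * (Real.pi / M)) ≤ Real.sin (n' * (Real.pi / M)) := by
        simpa using sin_step_le hN (m := 2) (n := n') (by omega) (by omega)
      rw [Real.sin_two_mul] at h2
      rw [add_zero, sin_pred_quarter hN (by omega)]
      have hc := cos_pi_div_pos hM h4
      have hsc := sin_le_cos_pi_div hM h4
      have h1' := Real.sin_sq_add_cos_sq (Real.pi / M)
      have hle : Real.sin (n * (Real.pi / M)) ≤ 1 := Real.sin_le_one _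
      rw [div_le_div_iff₀ (sin_step_pos hN hn1' (by omega)) hs]
      nlinarith [mul_le_mul_of_nonneg_left h2 hc.le, mul_le_mul_of_nonneg_right hle hs.le,
        mul_nonneg hs.le (sub_nonneg.mpr (pow_le_pow_left₀ hs.le hsc 2))]
  · rw [show M / 2 - 1 + 1 = M / 2 by omega, hM1]
    gcongr
    exact Real.sin_le_one _

theorem isRatio_diffPoint {M : ℕ} (hM : M ≠ 0) (h4 : 4 ∣ M) {n : ℕ} (hn : 2 * n ≤ M) {p : ℤ}
    (hp : Odd (n + p)) :
    IsRatio M (((Real.sin (n * (Real.pi / M)) / Real.sin (Real.pi / M) : ℝ) : ℂ) * unitPhase M p)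
      (diffPoint M n (p + M)) (diffPoint M 1 0) := by
  have hs := sin_pi_div_pos hM h4
  have hsC : (Real.sin (Real.pi / M) : ℂ) ≠ 0 := by exact_mod_cast hs.ne'
  have hMe : Even (M : ℤ) := by
    obtain ⟨L, rfl⟩ := h4
    exact ⟨2 * L, by push_cast; ring⟩
  have h10 : diffPoint M 1 0 ≠ 0 := by
    unfold diffPoint
    rw [Int.cast_one, one_mul]
    refine mul_ne_zero ?_ (unitPhase_ne_zero _ _)
    exact_mod_cast (by positivity : 2 * Real.sin (Real.pi / M) ≠ 0)
  refine ⟨diffPoint_mem hM h4 (by rw [← add_assoc]; exact hp.add_even hMe),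
    diffPoint_mem hM h4 (by decide), h10, ?_⟩
  rw [eq_div_iff h10]
  unfold diffPoint
  rw [unitPhase_add_self hM, unitPhase_zero, Int.cast_one, one_mul, Int.cast_natCast]
  push_cast at hsC ⊢
  field_simp

theorem isRatio_maxModulus {M : ℕ} (hM : M ≠ 0) (h4 : 4 ∣ M) {e : ℕ} (he : e = 0 ∨ e = 1) :
    IsRatio M ((maxModulus M e : ℂ) * unitPhase M e)
      (diffPoint M (M / 2 - 1 + e : ℕ) (e + M)) (diffPoint M 1 0) := by
  refine isRatio_diffPoint hM h4 (by omega) ?_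
  obtain ⟨L, rfl⟩ := h4
  refine ⟨L + e - 1, ?_⟩
  omega

theorem mul_unitPhase_mem_diffConstellation {M : ℕ} (hM : M ≠ 0) (h4 : 4 ∣ M) {d : ℂ}
    (hd : d ∈ diffConstellation M) {k : ℤ} (hk : Even k) :
    d * unitPhase M k ∈ diffConstellation M := by
  obtain ⟨n, m, ho, rfl⟩ := (mem_diffConstellation_iff hM h4 d).mp hd
  rw [diffPoint_mul_unitPhase]
  exact diffPoint_mem hM h4 (by rw [← add_assoc]; exact ho.add_even hk)

/-- Rotating the numerator by a multiple of `2π/M` brings a singular fade state to one of the three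
rays next to a wedge point without increasing the distance. -/
theorem exists_rotated_numerator {M : ℕ} (hM : M ≠ 0) (h4 : 4 ∣ M) (e : ℤ) {dk dl : ℂ}
    (hdk : dk ∈ diffConstellation M) (hdl : dl ∈ diffConstellation M) (hk0 : dk ≠ 0)
    (hl0 : dl ≠ 0) {w : ℂ}
    (hw : |w.im| * Real.cos (Real.pi / M) ≤ w.re * Real.sin (Real.pi / M)) :
    ∃ dk' ∈ diffConstellation M, ∃ p : ℤ, (p = e ∨ p = e + 1 ∨ p = e - 1) ∧ ‖dk'‖ = ‖dk‖ ∧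
      -dk' / dl = ((‖dk‖ / ‖dl‖ : ℝ) : ℂ) * unitPhase M p ∧
      ‖dk' + unitPhase M e * w * dl‖ ≤ ‖dk + unitPhase M e * w * dl‖ := by
  obtain ⟨n, m, -, -, -, hk, -⟩ := exists_normal_form hM h4 hdk hk0
  obtain ⟨n', m', -, -, -, hl, -⟩ := exists_normal_form hM h4 hdl hl0
  have hratio := ratio_eq hM hk hl hl0
  set p₀ : ℤ := m - m' + M
  obtain ⟨q, hq, hev, hle⟩ := exists_closest_direction hM h4 hw (p₀ - e)
  have hratio' : -(dk * unitPhase M (q - (p₀ - e))) / dl =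
      ((‖dk‖ / ‖dl‖ : ℝ) : ℂ) * unitPhase M (e + q) := by
    rw [show e + q = p₀ + (q - (p₀ - e)) by ring, unitPhase_add, ← mul_assoc, ← hratio]
    ring
  refine ⟨dk * unitPhase M (q - (p₀ - e)), mul_unitPhase_mem_diffConstellation hM h4 hdk hev,
    e + q, by omega, ?_, hratio', ?_⟩
  · rw [norm_mul, norm_unitPhase, mul_one]
  · rw [norm_add_mul_eq hl0 hratio'.symm, norm_add_mul_eq hl0 hratio.symm,
      norm_unitPhase_mul_sub, norm_unitPhase_mul_sub]
    refine mul_le_mul_of_nonneg_left ?_ (norm_nonneg dl)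
    rw [norm_le_iff_normSq_sub, normSq_sub_mul_unitPhase, normSq_sub_mul_unitPhase,
      show e + q - e = q by ring]
    have : 0 ≤ ‖dk‖ / ‖dl‖ := by positivity
    nlinarith [mul_le_mul_of_nonneg_left hle this]

/-! ### The region as wedge, circle, ray and disc conditions -/

/-- The cross terms of the two squares coincide. This gives both the unit circle condition and the
reduction to numerators at least as long as denominators. -/
theorem normSq_swap_sub (dk dl z : ℂ) :
    Complex.normSq (dk + z * dl) -
      Complex.normSq ((starRingEnd ℂ) dl + z * (starRingEnd ℂ) dk) =
      (Complex.normSq dk - Complex.normSq dl) * (1 - Complex.normSq z) := by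
  simp only [Complex.normSq_apply, Complex.add_re, Complex.add_im, Complex.mul_re, Complex.mul_im,
    Complex.conj_re, Complex.conj_im]
  ring

/-- The transition boundary conditions with the singular fade states of modulus at least one on
the three rays `kπ/M`, `k = e, e + 1, e - 1`. -/
def RayConditions (M : ℕ) (e : ℤ) (h dk dl z : ℂ) : Prop :=
  ∀ h' dk' dl' : ℂ, IsRatio M h' dk' dl' →
    (∃ p : ℤ, (p = e ∨ p = e + 1 ∨ p = e - 1) ∧ h' = ‖h'‖ * unitPhase M p) → h' ≠ h → 1 ≤ ‖h'‖ →
    ‖dk + z * dl‖ ≤ ‖dk' + z * dl'‖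

section Region

variable {lam M : ℕ} {e : ℕ} {h dk dl w : ℂ}

theorem le_of_rayConditions (hM : M = 2 ^ lam) (h4 : 4 ∣ M)
    (hr : IsRatio M h dk dl) (hout : 1 < ‖h‖)
    (hw : |w.im| * Real.cos (Real.pi / M) ≤ w.re * Real.sin (Real.pi / M))
    (hray : RayConditions M e h dk dl (unitPhase M e * w)) {dk' dl' : ℂ}
    (hdk' : dk' ∈ diffConstellation M) (hdl' : dl' ∈ diffConstellation M) (hl0 : dl' ≠ 0)
    (hle : ‖dl'‖ ≤ ‖dk'‖) :
    ‖dk + unitPhase M e * w * dl‖ ≤ ‖dk' + unitPhase M e * w * dl'‖ := by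
  have hM0 : M ≠ 0 := by rw [hM]; positivity
  have hlpos : 0 < ‖dl'‖ := norm_pos_iff.mpr hl0
  have hk0 : dk' ≠ 0 := norm_pos_iff.mp (hlpos.trans_le hle)
  obtain ⟨dk'', hmem, p, hp, hn, hq, hd⟩ :=
    exists_rotated_numerator hM0 h4 (e : ℤ) hdk' hdl' hk0 hl0 hw
  refine le_trans ?_ hd
  have hr' : IsRatio M (-dk'' / dl') dk'' dl' := ⟨hmem, hdl', hl0, rfl⟩
  have hnorm : ‖-dk'' / dl'‖ = ‖dk'‖ / ‖dl'‖ := by rw [norm_div, norm_neg, hn]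
  by_cases heq : -dk'' / dl' = h
  · rw [norm_add_mul_eq hr.2.2.1 hr.2.2.2, norm_add_mul_eq hl0 heq.symm,
      norm_denominator_unique hM h4 hr (heq ▸ hr') hout]
  · refine hray _ dk'' dl' hr' ⟨p, hp, by rw [hnorm]; exact hq⟩ heq ?_
    rw [hnorm, one_le_div hlpos]
    exact hle

theorem norm_unitPhase_mul_sub_le_iff (M : ℕ) (e : ℤ) (w : ℂ) (ρ ρ' : ℝ) :
    ‖unitPhase M e * w - ρ * unitPhase M e‖ ≤ ‖unitPhase M e * w - ρ' * unitPhase M e‖ ↔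
      ρ ^ 2 - ρ' ^ 2 ≤ 2 * (ρ - ρ') * w.re := by
  rw [norm_unitPhase_mul_sub, norm_unitPhase_mul_sub, norm_le_iff_normSq_sub,
    normSq_sub_mul_unitPhase, normSq_sub_mul_unitPhase]
  simp only [sub_self, Int.cast_zero, zero_mul, Real.cos_zero, Real.sin_zero, mul_one, mul_zero,
    add_zero]
  constructor <;> intro h <;> linarith

theorem norm_maxModulus_mul (hM : M ≠ 0) (h4 : 4 ∣ M) (he : e = 0 ∨ e = 1) :
    ‖(maxModulus M e : ℂ) * unitPhase M e‖ = maxModulus M e := by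
  have hs := sin_pi_div_pos hM h4
  have := sin_step_nonneg (half_mul_step hM h4) (n := M / 2 - 1 + e) (by omega)
  have h0 : 0 ≤ maxModulus M e := by unfold maxModulus; positivity
  rw [norm_mul, norm_unitPhase, mul_one, Complex.norm_real, Real.norm_eq_abs, abs_of_nonneg h0]

theorem norm_diffPoint_one (hM : M ≠ 0) (h4 : 4 ∣ M) :
    ‖diffPoint M 1 0‖ = 2 * Real.sin (Real.pi / M) := by
  have := norm_diffPoint hM h4 (n := 1) (by omega) 0
  simpa using this

/-- The outermost state has one representation with the shortest denominator, and |h| > 1 makes the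
modulus of the denominator unique. -/
theorem norm_denominator_of_outermost (hM : M = 2 ^ lam) (h4 : 4 ∣ M) (he : e = 0 ∨ e = 1)
    (hr : IsRatio M h dk dl) (hline : h = ‖h‖ * unitPhase M e) (hout : 1 < ‖h‖)
    (hmax : maxModulus M e ≤ ‖h‖) : ‖dl‖ = 2 * Real.sin (Real.pi / M) := by
  have hM0 : M ≠ 0 := by rw [hM]; positivity
  have heq : ‖h‖ = maxModulus M e := le_antisymm (norm_le_maxModulus hM0 h4 he hr hline) hmax
  rw [heq] at hline
  have hr' := isRatio_maxModulus hM0 h4 he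
  rw [← hline] at hr'
  rw [norm_denominator_unique hM h4 hr hr' hout, norm_diffPoint_one hM0 h4]

theorem norm_add_mul_le_two_sin (hM : M = 2 ^ lam) (h4 : 4 ∣ M) (he : e = 0 ∨ e = 1)
    (hr : IsRatio M h dk dl) (hline : h = ‖h‖ * unitPhase M e) (hout : 1 < ‖h‖)
    (hw : |w.im| * Real.cos (Real.pi / M) ≤ w.re * Real.sin (Real.pi / M))
    (hray : RayConditions M e h dk dl (unitPhase M e * w))
    (hdisc : maxModulus M e ≤ ‖h‖ → ‖unitPhase M e * w - h‖ ≤ 1) :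
    ‖dk + unitPhase M e * w * dl‖ ≤ 2 * Real.sin (Real.pi / M) := by
  have hM0 : M ≠ 0 := by rw [hM]; positivity
  have hs := sin_pi_div_pos hM0 h4
  rcases le_or_gt (maxModulus M e) ‖h‖ with hmax | hlt
  · rw [norm_add_mul_eq hr.2.2.1 hr.2.2.2, norm_denominator_of_outermost hM h4 he hr hline hout hmax]
    exact mul_le_of_le_one_right (by positivity) (hdisc hmax)
  · have hH := isRatio_maxModulus hM0 h4 he
    have hHn := norm_maxModulus_mul hM0 h4 he
    have hne : (maxModulus M e : ℂ) * unitPhase M e ≠ h := by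
      intro heq
      rw [heq] at hHn
      exact hlt.ne hHn
    have hcomp := hray _ _ _ hH ⟨e, Or.inl rfl, by rw [hHn]⟩ hne (by rw [hHn]; linarith)
    rw [norm_add_mul_eq hr.2.2.1 hr.2.2.2, norm_add_mul_eq hH.2.2.1 hH.2.2.2,
      norm_diffPoint_one hM0 h4] at hcomp
    have hdl := two_sin_le_norm hM0 h4 hr.2.1 hr.2.2.1
    have hcomp' : ‖unitPhase M e * w - h‖ ≤
        ‖unitPhase M e * w - (maxModulus M e : ℂ) * unitPhase M e‖ := by
      refine le_of_mul_le_mul_left ((mul_le_mul_of_nonneg_right hdl (norm_nonneg _)).trans hcomp) ?_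
      positivity
    -- As |dl| ≥ 2 sin x, z is no farther from h than from the outermost state on the same ray, so
    -- it lies on the inner side of their bisector.
    have hU : w.re ≤ maxModulus M e := by
      rw [hline, norm_unitPhase_mul_sub_le_iff] at hcomp'
      nlinarith
    rw [maxModulus, le_div_iff₀ hs, mul_comm] at hU
    obtain ⟨n, hn, hn1, p, hp, ho, hcov⟩ := wedge_cover (half_mul_step hM0 h4) (by omega)
      (by obtain ⟨L, rfl⟩ := h4; exact ⟨L, by omega⟩) he hw hU
    have hrn := isRatio_diffPoint hM0 h4 (n := n) (p := e + p) (by omega)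
      (by rw [← add_assoc]; exact ho)
    have hnn : 2 * n ≤ M := by omega
    refine (le_of_rayConditions hM h4 hr hout hw hray hrn.1 hrn.2.1 hrn.2.2.1 ?_).trans ?_
    · rw [norm_diffPoint_one hM0 h4]
      exact (norm_diffPoint hM0 h4 hnn _).symm ▸ by
        have := sin_step_le (half_mul_step hM0 h4) hn1 hn
        simp only [Nat.cast_one, one_mul] at this
        linarith
    · rw [norm_add_mul_eq hrn.2.2.1 hrn.2.2.2, norm_diffPoint_one hM0 h4, norm_unitPhase_mul_sub,
        add_sub_cancel_left]
      refine mul_le_of_le_one_right (by positivity) ?_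
      rw [← norm_one (α := ℂ), norm_le_iff_normSq_sub, map_one]
      refine le_of_mul_le_mul_left (a := Real.sin (Real.pi / M) ^ 2) ?_ (by positivity)
      have hid : Real.sin (Real.pi / M) ^ 2 * Complex.normSq (w -
          ((Real.sin (n * (Real.pi / M)) / Real.sin (Real.pi / M) : ℝ) : ℂ) * unitPhase M p) =
          (Real.sin (Real.pi / M) * w.re - Real.sin (n * (Real.pi / M)) *
            Real.cos (p * (Real.pi / M))) ^ 2 +
          (Real.sin (Real.pi / M) * w.im - Real.sin (n * (Real.pi / M)) *
            Real.sin (p * (Real.pi / M))) ^ 2 := by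
        simp only [Complex.normSq_apply, Complex.sub_re, Complex.sub_im, Complex.re_ofReal_mul,
          Complex.im_ofReal_mul, unitPhase_re, unitPhase_im]
        field_simp
      linarith

theorem le_of_conditions (hM : M = 2 ^ lam) (h4 : 4 ∣ M) (he : e = 0 ∨ e = 1)
    (hr : IsRatio M h dk dl) (hline : h = ‖h‖ * unitPhase M e) (hout : 1 < ‖h‖)
    (hw : |w.im| * Real.cos (Real.pi / M) ≤ w.re * Real.sin (Real.pi / M)) (hw1 : 1 ≤ ‖w‖)
    (hray : RayConditions M e h dk dl (unitPhase M e * w))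
    (hdisc : maxModulus M e ≤ ‖h‖ → ‖unitPhase M e * w - h‖ ≤ 1) {dk' dl' : ℂ}
    (hdk' : dk' ∈ diffConstellation M) (hdl' : dl' ∈ diffConstellation M)
    (hne : (dk', dl') ≠ (0, 0)) :
    ‖dk + unitPhase M e * w * dl‖ ≤ ‖dk' + unitPhase M e * w * dl'‖ := by
  have hM0 : M ≠ 0 := by rw [hM]; positivity
  have hz : ‖unitPhase M e * w‖ = ‖w‖ := by rw [norm_mul, norm_unitPhase, one_mul]
  by_cases hl0 : dl' = 0
  · have hk0 : dk' ≠ 0 := by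
      rintro rfl
      exact hne (by rw [hl0])
    rw [hl0, mul_zero, add_zero]
    exact (norm_add_mul_le_two_sin hM h4 he hr hline hout hw hray hdisc).trans
      (two_sin_le_norm hM0 h4 hdk' hk0)
  by_cases hk0 : dk' = 0
  · rw [hk0, zero_add, norm_mul, hz]
    have h1 := norm_add_mul_le_two_sin hM h4 he hr hline hout hw hray hdisc
    have h2 := two_sin_le_norm hM0 h4 hdl' hl0
    nlinarith [norm_nonneg dl']
  rcases le_or_gt ‖dl'‖ ‖dk'‖ with hle | hlt
  · exact le_of_rayConditions hM h4 hr hout hw hray hdk' hdl' hl0 hle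
  · have hsw := le_of_rayConditions hM h4 hr hout hw hray (conj_mem_diffConstellation hM0 h4 hdl')
      (conj_mem_diffConstellation hM0 h4 hdk') (by simpa using hk0)
      (by rw [Complex.norm_conj, Complex.norm_conj]; exact hlt.le)
    refine hsw.trans ?_
    rw [norm_le_iff_normSq_sub, ← neg_nonneg, neg_sub, normSq_swap_sub,
      Complex.normSq_eq_norm_sq, Complex.normSq_eq_norm_sq, Complex.normSq_eq_norm_sq, hz]
    apply mul_nonneg_of_nonpos_of_nonpos
    · rw [sub_nonpos]
      exact pow_le_pow_left₀ (norm_nonneg _) hlt.le 2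
    · nlinarith

theorem conditions_of_mem_fadeRegion (hM : M = 2 ^ lam) (h4 : 4 ∣ M) (he : e = 0 ∨ e = 1)
    (hr : IsRatio M h dk dl) (hline : h = ‖h‖ * unitPhase M e) (hout : 1 < ‖h‖)
    (hz : unitPhase M e * w ∈ fadeRegion M dk dl) :
    |w.im| * Real.cos (Real.pi / M) ≤ w.re * Real.sin (Real.pi / M) ∧ 1 ≤ ‖w‖ ∧
      RayConditions M e h dk dl (unitPhase M e * w) ∧
      (maxModulus M e ≤ ‖h‖ → ‖unitPhase M e * w - h‖ ≤ 1) := by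
  have hM0 : M ≠ 0 := by rw [hM]; positivity
  have hs := sin_pi_div_pos hM0 h4
  have hh : h ≠ 0 := by rintro rfl; norm_num at hout
  have hk0 := numerator_ne_zero hr hh
  have hl0 := hr.2.2.1
  have hlpos : 0 < ‖dl‖ := norm_pos_iff.mpr hl0
  have hlk : ‖dl‖ < ‖dk‖ := by rw [← norm_ratio hr]; nlinarith
  have hnz : ‖unitPhase M e * w‖ = ‖w‖ := by rw [norm_mul, norm_unitPhase, one_mul]
  have hrot : ∀ k : ℤ, Even k → unitPhase M k ≠ 1 →
      w.re * Real.cos (k * (Real.pi / M)) + w.im * Real.sin (k * (Real.pi / M)) ≤ w.re := by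
    intro k hk hk1
    have h1 := hz (dk * unitPhase M k) (mul_unitPhase_mem_diffConstellation hM0 h4 hr.1 hk) dl hr.2.1
      (by simp [hl0]) (by simp [hk0, hk1])
    have hq : h * unitPhase M k = -(dk * unitPhase M k) / dl := by rw [hr.2.2.2]; ring
    rw [norm_add_mul_eq hl0 hr.2.2.2, norm_add_mul_eq hl0 hq] at h1
    have h2 := le_of_mul_le_mul_left h1 hlpos
    rw [hline, mul_assoc, ← unitPhase_add, norm_unitPhase_mul_sub, norm_unitPhase_mul_sub,
      norm_le_iff_normSq_sub, normSq_sub_mul_unitPhase, normSq_sub_mul_unitPhase,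
      add_sub_cancel_left] at h2
    simp only [sub_self, Int.cast_zero, zero_mul, Real.cos_zero, Real.sin_zero, mul_one, mul_zero,
      add_zero] at h2
    have hpos : 0 < 2 * ‖h‖ := by linarith
    exact le_of_mul_le_mul_left (by linarith) hpos
  have hcos2 : Real.cos (2 * (Real.pi / M)) ≠ 1 := by
    rw [Real.cos_two_mul]
    have := Real.sin_sq_add_cos_sq (Real.pi / M)
    intro h; nlinarith
  refine ⟨?_, ?_, ?_, ?_⟩
  · have key : ∀ k : ℤ, k = 2 ∨ k = -2 → unitPhase M k ≠ 1 := by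
      intro k hk h1
      apply hcos2
      have h2 := unitPhase_re M k
      rw [h1, Complex.one_re] at h2
      rcases hk with rfl | rfl
      · exact_mod_cast h2.symm
      · push_cast at h2
        rw [neg_mul, Real.cos_neg] at h2
        exact h2.symm
    -- The bisectors between h and its rotations by ±2π/M are the two wedge lines.
    have h1 := hrot 2 (by decide) (key 2 (by simp))
    have h2 := hrot (-2) (by decide) (key (-2) (by simp))
    push_cast at h1 h2
    rw [neg_mul, Real.cos_neg, Real.sin_neg] at h2
    rw [Real.cos_two_mul, Real.sin_two_mul] at h1 h2
    have h3 := Real.sin_sq_add_cos_sq (Real.pi / M)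
    have h5 : w.re * (Real.sin (Real.pi / M) ^ 2 + Real.cos (Real.pi / M) ^ 2) = w.re * 1 := by
      rw [h3]
    rcases abs_choice w.im with hi | hi <;> rw [hi] <;>
      refine le_of_mul_le_mul_left ?_ hs <;> linarith
  · have h1 := hz _ (conj_mem_diffConstellation hM0 h4 hr.2.1) _
      (conj_mem_diffConstellation hM0 h4 hr.1) (by simp [hl0]) (by
        intro heq
        have h2 := congrArg norm (Prod.ext_iff.mp heq).1
        simp only [Complex.norm_conj] at h2
        exact hlk.ne h2)
    rw [norm_le_iff_normSq_sub, normSq_swap_sub, Complex.normSq_eq_norm_sq,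
      Complex.normSq_eq_norm_sq, Complex.normSq_eq_norm_sq, hnz] at h1
    have h2 : 0 < ‖dk‖ ^ 2 - ‖dl‖ ^ 2 := sub_pos.mpr (pow_lt_pow_left₀ hlk hlpos.le two_ne_zero)
    by_contra hlt
    have hlt' : ‖w‖ < 1 := not_le.mp hlt
    have : 0 < 1 - ‖w‖ ^ 2 := by nlinarith [norm_nonneg w]
    nlinarith
  · intro h' dk' dl' hr' _ hne _
    refine hz dk' hr'.1 dl' hr'.2.1 (by simp [hr'.2.2.1]) ?_
    intro heq
    obtain ⟨rfl, rfl⟩ := Prod.ext_iff.mp heq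
    exact hne (by rw [hr'.2.2.2, hr.2.2.2])
  · intro hmax
    have hd := norm_denominator_of_outermost hM h4 he hr hline hout hmax
    have h10 := (isRatio_maxModulus hM0 h4 he).2.2.1
    -- The competitor (2 sin x, 0) has constant distance 2 sin x = |dl|, which yields the unit disc
    -- about h.
    have h1 := hz (diffPoint M 1 0) (isRatio_maxModulus hM0 h4 he).2.1 0
      (zero_mem_diffConstellation hM0 h4) (by simp [h10]) (by simp [hl0.symm])
    rw [mul_zero, add_zero, norm_diffPoint_one hM0 h4, norm_add_mul_eq hl0 hr.2.2.2, hd] at h1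
    exact le_of_mul_le_mul_left (by linarith) (by positivity : 0 < 2 * Real.sin (Real.pi / M))

end Region

/-! ### The case M = 2 and the envelope as inequalities -/

/-- The two signals are opposite unit vectors, so every nonzero difference has modulus 2. This makes
the case λ = 1 vacuous and allows 4 ∣ M elsewhere. -/
theorem norm_ratio_le_one_of_two {h dk dl : ℂ} (hr : IsRatio 2 h dk dl) : ‖h‖ ≤ 1 := by
  have hsq : ∀ s ∈ psk 2, s ^ 2 = -1 ∧ ‖s‖ = 1 := by
    intro s hs
    obtain ⟨k, rfl⟩ := (mem_psk_iff two_ne_zero s).mp hs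
    refine ⟨?_, norm_unitPhase _ _⟩
    rw [sq, ← unitPhase_add, show 2 * k + 1 + (2 * k + 1) = ((2 : ℕ) : ℤ) + 2 * ((2 : ℕ) : ℤ) * k by
      push_cast; ring, unitPhase_add_mul_two_self two_ne_zero, unitPhase_self two_ne_zero]
  have hn := norm_ratio hr
  obtain ⟨⟨s, hs, s', hs', rfl⟩, ⟨t, ht, t', ht', rfl⟩, h0, -⟩ := hr
  have hle : ‖s - s'‖ ≤ 2 := by
    refine (norm_sub_le _ _).trans ?_
    rw [(hsq s hs).2, (hsq s' hs').2]; norm_num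
  have hdl : ‖t - t'‖ = 2 := by
    rcases sq_eq_sq_iff_eq_or_eq_neg.mp ((hsq t ht).1.trans (hsq t' ht').1.symm) with h | h
    · exact absurd (sub_eq_zero.mpr h) h0
    · rw [h, ← neg_add', norm_neg, ← two_mul, norm_mul, (hsq t' ht').2]; norm_num
  rw [hdl] at hn
  linarith

theorem unitPhase_mul_straightLine_form (M : ℕ) (e k : ℤ) (w : ℂ) :
    (unitPhase M e * w).re * Real.sin (k * (Real.pi / M)) -
      (unitPhase M e * w).im * Real.cos (k * (Real.pi / M)) =
    -(w.re * Real.sin ((e - k : ℤ) * (Real.pi / M)) +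
      w.im * Real.cos ((e - k : ℤ) * (Real.pi / M))) := by
  rw [show ((e - k : ℤ) : ℝ) * (Real.pi / M) = e * (Real.pi / M) - k * (Real.pi / M) by
    push_cast; ring, Real.sin_sub, Real.cos_sub, Complex.mul_re, Complex.mul_im, unitPhase_re,
    unitPhase_im]
  ring

section Region

variable {M : ℕ} {e : ℕ} {h : ℂ}

theorem closedSide_right_wedgeLine (hM : M ≠ 0) (h4 : 4 ∣ M) (hline : h = ‖h‖ * unitPhase M e)
    (hh : 0 < ‖h‖) {φ : ℝ} (hφ : φ = ((e - 1 : ℤ) : ℝ) * (Real.pi / M)) (w : ℂ) :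
    unitPhase M e * w ∈ closedSide (straightLine φ) h ↔
      -w.im * Real.cos (Real.pi / M) ≤ w.re * Real.sin (Real.pi / M) := by
  have hs := sin_pi_div_pos hM h4
  have hform : ∀ v : ℂ, (unitPhase M e * v).re * Real.sin φ - (unitPhase M e * v).im * Real.cos φ =
      -(v.re * Real.sin (Real.pi / M) + v.im * Real.cos (Real.pi / M)) := by
    intro v
    rw [hφ, unitPhase_mul_straightLine_form]
    simp
  rw [closedSide_straightLine_of_neg, Set.mem_ofPred_eq, hform]
  · constructor <;> intro h <;> linarith
  · rw [hline, mul_comm (‖h‖ : ℂ), hform]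
    simp only [Complex.ofReal_re, Complex.ofReal_im]
    have := mul_pos hh hs
    linarith

theorem closedSide_left_wedgeLine (hM : M ≠ 0) (h4 : 4 ∣ M) (hline : h = ‖h‖ * unitPhase M e)
    (hh : 0 < ‖h‖) {φ : ℝ} (hφ : φ = ((e + 1 : ℤ) : ℝ) * (Real.pi / M)) (w : ℂ) :
    unitPhase M e * w ∈ closedSide (straightLine φ) h ↔
      w.im * Real.cos (Real.pi / M) ≤ w.re * Real.sin (Real.pi / M) := by
  have hs := sin_pi_div_pos hM h4
  have hform : ∀ v : ℂ, (unitPhase M e * v).re * Real.sin φ - (unitPhase M e * v).im * Real.cos φ =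
      v.re * Real.sin (Real.pi / M) - v.im * Real.cos (Real.pi / M) := by
    intro v
    rw [hφ, unitPhase_mul_straightLine_form]
    simp
    ring
  rw [closedSide_straightLine_of_pos, Set.mem_ofPred_eq, hform]
  · constructor <;> intro h <;> linarith
  · rw [hline, mul_comm (‖h‖ : ℂ), hform]
    simp only [Complex.ofReal_re, Complex.ofReal_im]
    have := mul_pos hh hs
    linarith

/-- The inner envelope region in terms of inequalities between distances. -/
theorem mem_innerEnvelopeRegion_iff (hM : M ≠ 0) (h4 : 4 ∣ M) (he : e = 0 ∨ e = 1) {a : ℝ}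
    (ha : a = e * (Real.pi / M)) {dk dl : ℂ} (hr : IsRatio M h dk dl)
    (hline : h = ‖h‖ * unitPhase M e) (hout : 1 < ‖h‖) (w : ℂ) :
    unitPhase M e * w ∈ innerEnvelopeRegion h
        (sameLineCurves M a h dk dl ∪ neighbourLineCurves M a dk dl ∪ wedgeLines M a) ↔
      |w.im| * Real.cos (Real.pi / M) ≤ w.re * Real.sin (Real.pi / M) ∧ 1 ≤ ‖w‖ ∧
      RayConditions M e h dk dl (unitPhase M e * w) ∧
      (maxModulus M e ≤ ‖h‖ → ‖unitPhase M e * w - h‖ ≤ 1) := by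
  have hhpos : 0 < ‖h‖ := by linarith
  have hnz : ‖unitPhase M e * w‖ = ‖w‖ := by rw [norm_mul, norm_unitPhase, one_mul]
  have ha0 : a = ((e : ℤ) : ℝ) * (Real.pi / M) := by rw [ha]; push_cast; ring
  have ha1 : a - Real.pi / M = ((e - 1 : ℤ) : ℝ) * (Real.pi / M) := by rw [ha]; push_cast; ring
  have ha2 : a + Real.pi / M = ((e + 1 : ℤ) : ℝ) * (Real.pi / M) := by rw [ha]; push_cast; ring
  have houter : (¬ ∃ h' : ℂ, IsSingularFadeState M h' ∧ h' ∈ phaseRay a ∧ ‖h‖ < ‖h'‖) ↔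
      maxModulus M e ≤ ‖h‖ := by
    constructor
    · intro hno
      by_contra hlt
      have hn := norm_maxModulus_mul hM h4 he
      refine hno ⟨(maxModulus M e : ℂ) * unitPhase M e, (isSingularFadeState_iff _ _).mpr
        ⟨_, _, isRatio_maxModulus hM h4 he⟩, (mem_phaseRay_iff _ ha0 _).mpr (by rw [hn]), ?_⟩
      rw [hn]
      exact not_le.mp hlt
    · rintro hle ⟨h', hs, hray, hlt⟩
      obtain ⟨dk', dl', hr'⟩ := (isSingularFadeState_iff _ _).mp hs
      have := norm_le_maxModulus hM h4 he hr' ((mem_phaseRay_iff _ ha0 _).mp hray)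
      linarith
  -- The neighbouring rays are not required to avoid h; they do, since equal directions have indices
  -- of equal parity.
  have hneigh : ∀ h' : ℂ, (h' ∈ phaseRay (a - Real.pi / M) ∨ h' ∈ phaseRay (a + Real.pi / M)) →
      h' ≠ h := by
    intro h' hor heq
    subst heq
    have key : ∀ p : ℤ, h' = ‖h'‖ * unitPhase M p → Even (p - e) := by
      intro p hp
      apply even_sub_of_unitPhase_eq hM
      rw [hp] at hline
      simp only [norm_mul, Complex.norm_real, norm_norm, norm_unitPhase, mul_one] at hline
      exact mul_left_cancel₀ (by simpa using hhpos.ne') hline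
    rcases hor with h1 | h1
    · have := key _ ((mem_phaseRay_iff _ ha1 _).mp h1)
      grind
    · have := key _ ((mem_phaseRay_iff _ ha2 _).mp h1)
      grind
  have htb : ∀ {h' dk' dl' : ℂ}, IsRatio M h' dk' dl' → h' ≠ h →
      closedSide (transitionBoundary dk dl dk' dl') h = {z | ‖dk + z * dl‖ ≤ ‖dk' + z * dl'‖} :=
    fun hr' hne => closedSide_transitionBoundary hr.2.2.1 hr'.2.2.1 hr.2.2.2 hr'.2.2.2 hne
  constructor
  · intro hz
    have hsub : ∀ C ∈ sameLineCurves M a h dk dl ∪ neighbourLineCurves M a dk dl ∪ wedgeLines M a,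
      unitPhase M e * w ∈ closedSide C h := hz
    refine ⟨?_, ?_, ?_, ?_⟩
    · have h1 := hsub _ (Or.inr (Or.inl rfl))
      have h2 := hsub _ (Or.inr (Or.inr rfl))
      rw [closedSide_right_wedgeLine hM h4 hline hhpos ha1] at h1
      rw [closedSide_left_wedgeLine hM h4 hline hhpos ha2] at h2
      rcases abs_choice w.im with hi | hi <;> rw [hi] <;> assumption
    · have h1 := hsub _ (Or.inl (Or.inl (Or.inl (Or.inl rfl))))
      rw [closedSide_unitCircle hout, Set.mem_ofPred_eq, hnz] at h1
      exact h1
    · rintro h' dk' dl' hr' ⟨p, hp, hray⟩ hne h1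
      have hmem : unitPhase M e * w ∈ closedSide (transitionBoundary dk dl dk' dl') h := by
        apply hsub
        rcases hp with rfl | rfl | rfl
        · exact Or.inl (Or.inl (Or.inl (Or.inr
            ⟨h', dk', dl', hr', (mem_phaseRay_iff _ ha0 _).mpr hray, hne, h1, rfl⟩)))
        · exact Or.inl (Or.inr
            ⟨h', dk', dl', hr', Or.inr ((mem_phaseRay_iff _ ha2 _).mpr hray), h1, rfl⟩)
        · exact Or.inl (Or.inr
            ⟨h', dk', dl', hr', Or.inl ((mem_phaseRay_iff _ ha1 _).mpr hray), h1, rfl⟩)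
      rw [htb hr' hne] at hmem
      exact hmem
    · intro hmax
      have h1 := hsub _ (Or.inl (Or.inl (Or.inr ⟨houter.mpr hmax, rfl⟩)))
      rw [closedSide_unitCircle_center] at h1
      exact h1
  · rintro ⟨hw, hw1, hray, hdisc⟩ C hC
    have hc := cos_pi_div_pos hM h4
    rcases hC with (((rfl | ⟨h', dk', dl', hr', hmem, hne, h1, rfl⟩) | ⟨hno, rfl⟩) |
      ⟨h', dk', dl', hr', hmem, h1, rfl⟩) | (rfl | rfl)
    · rw [closedSide_unitCircle hout, Set.mem_ofPred_eq, hnz]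
      exact hw1
    · rw [htb hr' hne]
      exact hray h' dk' dl' hr' ⟨e, Or.inl rfl, (mem_phaseRay_iff _ ha0 _).mp hmem⟩ hne h1
    · rw [closedSide_unitCircle_center]
      exact hdisc (houter.mp hno)
    · rw [htb hr' (hneigh h' hmem)]
      refine hray h' dk' dl' hr' ?_ (hneigh h' hmem) h1
      rcases hmem with hm | hm
      · exact ⟨e - 1, by simp, (mem_phaseRay_iff _ ha1 _).mp hm⟩
      · exact ⟨e + 1, by simp, (mem_phaseRay_iff _ ha2 _).mp hm⟩
    · rw [closedSide_right_wedgeLine hM h4 hline hhpos ha1]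
      exact (mul_le_mul_of_nonneg_right (neg_le_abs _) hc.le).trans hw
    · rw [closedSide_left_wedgeLine hM h4 hline hhpos ha2]
      exact (mul_le_mul_of_nonneg_right (le_abs_self _) hc.le).trans hw

end Region

theorem theorem2 (lam M : ℕ) (hlam : 1 ≤ lam) (hM : M = 2 ^ lam)
    (a : ℝ) (ha : a = 0 ∨ a = Real.pi / M)
    (h dk dl : ℂ) (hratio : IsRatio M h dk dl)
    (hline : h ∈ phaseRay a) (hout : 1 < ‖h‖) :
    fadeRegion M dk dl =
      innerEnvelopeRegion h
        (sameLineCurves M a h dk dl ∪ neighbourLineCurves M a dk dl ∪ wedgeLines M a) := by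
  have hM0 : M ≠ 0 := by rw [hM]; positivity
  have h4 : 4 ∣ M := by
    rcases hlam.eq_or_lt with rfl | h2
    · obtain rfl : M = 2 := by rw [hM]; norm_num
      exact absurd (norm_ratio_le_one_of_two hratio) (not_le.mpr hout)
    · rw [hM]
      exact pow_dvd_pow 2 (show 2 ≤ lam from h2)
  obtain ⟨e, he, hae⟩ : ∃ e : ℕ, (e = 0 ∨ e = 1) ∧ a = e * (Real.pi / M) := by
    rcases ha with rfl | rfl
    · exact ⟨0, Or.inl rfl, by simp⟩
    · exact ⟨1, Or.inr rfl, by simp⟩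
  have hray : h = ‖h‖ * unitPhase M e :=
    (mem_phaseRay_iff _ (by rw [hae]; push_cast; ring) _).mp hline
  ext z
  obtain ⟨w, rfl⟩ : ∃ w, z = unitPhase M e * w :=
    ⟨z / unitPhase M e, by rw [mul_div_cancel₀ _ (unitPhase_ne_zero _ _)]⟩
  rw [mem_innerEnvelopeRegion_iff hM0 h4 he hae hratio hray hout]
  constructor
  · exact conditions_of_mem_fadeRegion hM h4 he hratio hray hout
  · rintro ⟨hw, hw1, hcond, hdisc⟩ dk' hdk' dl' hdl' hne _
    exact le_of_conditions hM h4 he hratio hray hout hw hw1 hcond hdisc hdk' hdl' hne
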